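/- Let $k$ be a field of characteristic $0$, $L=k(\sqrt d)$ a quadratic extension, $n\ge 2$, and $G=\mathrm{SU}_{2n}(L,h)$, that is, for a commutative $k$-algebra $R$ and $R_L=R\otimes_k L$ with conjugation $a+b\sqrt d\mapsto a-b\sqrt d$, $$G(R)=\{X\in \mathrm{SL}_{2n}(R_L) : X^*\mathcal J X=\mathcal J\},$$ where $\mathcal J$ is block diagonal with $n$ blocks $\begin{pmatrix}0&-1\\1&0\end{pmatrix}$. Let $\Phi_k$ be the relative root system (of type $\mathsf C_n$) with respect to the torus of matrices $\mathrm{diag}(t_1,t_1^{-1},\dots,t_n,t_n^{-1})$. For $\alpha\in\Phi_k$ put $V_\alpha(R)=R$ if $\alpha$ is long and $V_\alpha(R)=R_L$ if $\alpha$ is short. With $\alpha_i$ ($i$ odd, $1\le i<2n$) the character giving the $i$-th diagonal entry and $E_{pq}(x)$ the matrix with $x$ in position $(p,q)$ and $0$ elsewhere, let $X_\alpha:V_\alpha(R)\to G(R)$ be the root maps $$X_{2\alpha_i}(x)=1+E_{i,i+1}(x),\quad X_{-2\alpha_i}(x)=1+E_{i+1,i}(x),\quad X_{\alpha_i-\alpha_j}(x)=1+E_{ij}(x)-E_{j+1,i+1}(\bar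 x)\ (i\ne j),$$ $$X_{\alpha_i+\alpha_j}(x)=1+E_{i,j+1}(x)+E_{j,i+1}(\bar x),\quad X_{-\alpha_i-\alpha_j}(x)=1+E_{j+1,i}(x)+E_{i+1,j}(\bar x)\ (i<j).$$ For $\alpha\ne\pm\beta$ let $N_{ij}^{\alpha\beta}$ be the polynomial maps in the Chevalley commutator formula $$[X_\alpha(u),X_\beta(v)]=\prod_{i,j\ge 1,\ i\alpha+j\beta\in\Phi_k}X_{i\alpha+j\beta}\big(N_{ij}^{\alpha\beta}(u,v)\big).$$ The Steinberg group $\widetilde G(R)$ is generated by symbols $\widetilde X_\alpha(v)$ ($\alpha\in\Phi_k$, $v\in V_\alpha(R)$) subject to $\widetilde X_\alpha(v)\widetilde X_\alpha(w)=\widetilde X_\alpha(v+w)$ and, for $\alpha\neq\pm\beta$, the commutator formula above with $\widetilde X$ in place of $X$; $\pi_R:\widetilde G(R)\to G(R)$ is the homomorphism $\widetilde X_\alpha(v)\mapsto X_\alpha(v)$. **Proposition 3.5.** Let $K$ be an algebraically closed field of characteristic $0$, $\rho:G(k)\to \mathrm{GL}_m(K)$ an abstract group homomorphism, and $H=\overline{\rho(G(k))}$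 the Zariski closure of its image. Let $A$ be a finite-dimensional commutative $K$-algebra, $f:k\to A$ a ring homomorphism with Zariski-dense image (through which $A$ is regarded as a $k$-algebra), and, for each $\alpha\in\Phi_k$, let $\psi_\alpha:V_\alpha(A)\to H$ be a regular map such that $\psi_\alpha\circ V_\alpha(f)=\rho\circ X_\alpha$ on $V_\alpha(k)$, where $V_\alpha(f):V_\alpha(k)\to V_\alpha(A)$ is induced by $f$. Let $\widetilde F:\widetilde G(k)\to\widetilde G(A)$ be the homomorphism induced by $f$. Then there exists a group homomorphism $\widetilde\sigma:\widetilde G(A)\to H$ such that $$\widetilde\sigma\circ\widetilde F=\rho\circ\pi_k\qquad\text{and}\qquad \widetilde\sigma\circ\widetilde X_\alpha=\psi_\alpha\ \text{ for all }\alpha\in\Phi_k .$$ -/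

import Mathlib

open scoped Matrix commutatorElement

noncomputable section

namespace QuasiSplitSU

section Basic

variable {k : Type*} [Field k] (n : ℕ) (R : Type*) [CommRing R] [Algebra k R] (d : k)

/-- `R_L = R ⊗_k L` for `L = k(√d)`: the free `R`-module with basis `1, √d`, where `(√d)² = d`.
In particular `QuadExt k d` is `L` itself. The element `a + b√d` is `⟨a, b⟩`, and `star` is the
conjugation `a + b√d ↦ a - b√d`, i.e. the extension of the nontrivial element of `Gal(L/k)`. -/
abbrev QuadExt : Type _ := QuadraticAlgebra R (algebraMap k R d) 0

/-- The map `a + b√d ↦ g(a) + g(b)√d` from `R_L` to `S_L` induced by `g : R → S`. -/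
def QuadExt.map {R S : Type*} [CommRing R] [Algebra k R] [CommRing S] [Algebra k S] (d : k)
    (g : R →ₐ[k] S) : QuadExt R d →+* QuadExt S d where
  toFun z := ⟨g z.re, g z.im⟩
  map_one' := by ext <;> simp [QuadraticAlgebra.re_one, QuadraticAlgebra.im_one]
  map_mul' x y := by ext <;> simp
  map_zero' := by ext <;> simp
  map_add' x y := by ext <;> simp

lemma QuadExt.map_star {R S : Type*} [CommRing R] [Algebra k R] [CommRing S] [Algebra k S] (d : k)
    (g : R →ₐ[k] S) (z : QuadExt R d) :
    QuadExt.map d g (star z) = star (QuadExt.map d g z) := by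
  ext <;> simp [QuadExt.map]

/-- The index set of the rows and columns of `2n × 2n` matrices, arranged in `n` consecutive
pairs: `(0, a)` and `(1, a)` are the first and the second index of the `a`-th pair. -/
abbrev Idx : Type := Fin 2 × Fin n

/-- The matrix of the skew-hermitian form `h`, with `n` diagonal blocks `(0 -1; 1 0)`. -/
def formMatrix (B : Type*) [CommRing B] : Matrix (Idx n) (Idx n) B :=
  Matrix.blockDiagonal fun _ : Fin n => !![0, -1; 1, 0]

/-- The group `G(R) = SU_{2n}(L, h)(R)` of all `X ∈ SL_{2n}(R_L)` with `X* H X = H`. -/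
def SU : Subgroup (Matrix.SpecialLinearGroup (Idx n) (QuadExt R d)) where
  carrier := {X | X.1ᴴ * formMatrix n _ * X.1 = formMatrix n _}
  one_mem' := by simp
  mul_mem' {X Y} hX hY := by
    simp only [Set.mem_ofPred_eq, Matrix.SpecialLinearGroup.coe_mul,
      Matrix.conjTranspose_mul] at *
    calc _ = Y.1ᴴ * (X.1ᴴ * formMatrix n _ * X.1) * Y.1 := by simp only [Matrix.mul_assoc]
      _ = _ := by rw [hX, hY]
  inv_mem' {X} hX := by
    simp only [Set.mem_ofPred_eq] at *
    have h1 : X.1 * (X⁻¹).1 = 1 := by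
      rw [← Matrix.SpecialLinearGroup.coe_mul, mul_inv_cancel, Matrix.SpecialLinearGroup.coe_one]
    have h2 : (X⁻¹).1ᴴ * X.1ᴴ = 1 := by
      rw [← Matrix.conjTranspose_mul, h1, Matrix.conjTranspose_one]
    calc _ = (X⁻¹).1ᴴ * (X.1ᴴ * formMatrix n _ * X.1) * (X⁻¹).1 := by rw [hX]
      _ = ((X⁻¹).1ᴴ * X.1ᴴ) * formMatrix n _ * (X.1 * (X⁻¹).1) := by
        simp only [Matrix.mul_assoc]
      _ = _ := by rw [h1, h2, Matrix.one_mul, Matrix.mul_one]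

end Basic

/-- The relative root system `Φ_k` of `SU_{2n}(L, h)`, of type `C_n`, with respect to the torus of
diagonal matrices `diag(t_1, t_1⁻¹, …, t_n, t_n⁻¹)`. With `ε_a` the character `t_a`, the roots are
`2ε_a`, `-2ε_a` (long), `ε_a - ε_b` for `a ≠ b`, and `ε_a + ε_b`, `-ε_a - ε_b` for `a < b`
(short). -/
inductive Root (n : ℕ) : Type
  | posLong (a : Fin n)
  | negLong (a : Fin n)
  | diff (a b : Fin n) (h : a ≠ b)
  | posSum (a b : Fin n) (h : a < b)
  | negSum (a b : Fin n) (h : a < b)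

/-- A root as an element of the character group `ℤⁿ` of the torus, with basis `ε_1, …, ε_n`. -/
def Root.toChar {n : ℕ} : Root n → (Fin n → ℤ)
  | .posLong a => 2 • Pi.single a 1
  | .negLong a => -(2 • Pi.single a 1)
  | .diff a b _ => Pi.single a 1 - Pi.single b 1
  | .posSum a b _ => Pi.single a 1 + Pi.single b 1
  | .negSum a b _ => -(Pi.single a 1 + Pi.single b 1)

/-- `V_α(R)`, which is `R` if `α` is long and `R_L` if `α` is short. -/
def RootSpace {k : Type*} [Field k] (d : k) {n : ℕ} (α : Root n)
    (R : Type*) [CommRing R] [Algebra k R] : Type _ :=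
  match α with
  | .posLong _ => R
  | .negLong _ => R
  | .diff _ _ _ => QuadExt R d
  | .posSum _ _ _ => QuadExt R d
  | .negSum _ _ _ => QuadExt R d

section RootSpace

variable {k : Type*} [Field k] (d : k) {n : ℕ} (α : Root n)

instance (R : Type*) [CommRing R] [Algebra k R] : AddCommGroup (RootSpace d α R) :=
  match α with
  | .posLong _ => inferInstanceAs (AddCommGroup R)
  | .negLong _ => inferInstanceAs (AddCommGroup R)
  | .diff _ _ _ => inferInstanceAs (AddCommGroup (QuadExt R d))
  | .posSum _ _ _ => inferInstanceAs (AddCommGroup (QuadExt R d))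
  | .negSum _ _ _ => inferInstanceAs (AddCommGroup (QuadExt R d))

instance (K : Type*) [Semiring K] (R : Type*) [CommRing R] [Algebra k R] [Module K R] :
    Module K (RootSpace d α R) :=
  match α with
  | .posLong _ => inferInstanceAs (Module K R)
  | .negLong _ => inferInstanceAs (Module K R)
  | .diff _ _ _ => inferInstanceAs (Module K (QuadExt R d))
  | .posSum _ _ _ => inferInstanceAs (Module K (QuadExt R d))
  | .negSum _ _ _ => inferInstanceAs (Module K (QuadExt R d))

variable {R S : Type*} [CommRing R] [Algebra k R] [CommRing S] [Algebra k S]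

/-- The map `V_α(g) : V_α(R) → V_α(S)` induced by `g : R → S`. -/
def RootSpace.map (g : R →ₐ[k] S) : RootSpace d α R →+ RootSpace d α S :=
  match α with
  | .posLong _ => (g : R →+ S)
  | .negLong _ => (g : R →+ S)
  | .diff _ _ _ => (QuadExt.map d g : QuadExt R d →+ QuadExt S d)
  | .posSum _ _ _ => (QuadExt.map d g : QuadExt R d →+ QuadExt S d)
  | .negSum _ _ _ => (QuadExt.map d g : QuadExt R d →+ QuadExt S d)

end RootSpace

section RootElements

variable {k : Type*} [Field k] {n : ℕ} {R S : Type*} [CommRing R] [Algebra k R]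
  [CommRing S] [Algebra k S] {d : k}

/-- `1 + E_{i,i+1}(x)`, for the odd index `i` of the `a`-th pair.
Here `Matrix.single p q x` is the matrix `E_{pq}(x)`. -/
def posLongMatrix {B : Type*} [CommRing B] (a : Fin n) (x : B) : Matrix (Idx n) (Idx n) B :=
  1 + Matrix.single (0, a) (1, a) x

/-- `1 + E_{i+1,i}(x)`. -/
def negLongMatrix {B : Type*} [CommRing B] (a : Fin n) (x : B) : Matrix (Idx n) (Idx n) B :=
  1 + Matrix.single (1, a) (0, a) x

/-- `1 + E_{ij}(x) - E_{j+1,i+1}(x̄)`. -/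
def diffMatrix {B : Type*} [CommRing B] [StarRing B] (a b : Fin n) (x : B) :
    Matrix (Idx n) (Idx n) B :=
  1 + Matrix.single (0, a) (0, b) x - Matrix.single (1, b) (1, a) (star x)

/-- `1 + E_{i,j+1}(x) + E_{j,i+1}(x̄)`. -/
def posSumMatrix {B : Type*} [CommRing B] [StarRing B] (a b : Fin n) (x : B) :
    Matrix (Idx n) (Idx n) B :=
  1 + Matrix.single (0, a) (1, b) x + Matrix.single (0, b) (1, a) (star x)

/-- `1 + E_{j+1,i}(x) + E_{i+1,j}(x̄)`. -/
def negSumMatrix {B : Type*} [CommRing B] [StarRing B] (a b : Fin n) (x : B) :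
    Matrix (Idx n) (Idx n) B :=
  1 + Matrix.single (1, b) (0, a) x + Matrix.single (1, a) (0, b) (star x)

/-- The matrix of the root element `X_α(v)`. For long roots, `R` is embedded in `R_L`. -/
def rootMatrix : (α : Root n) → RootSpace d α R → Matrix (Idx n) (Idx n) (QuadExt R d)
  | .posLong a, (x : R) => posLongMatrix a (algebraMap R (QuadExt R d) x)
  | .negLong a, (x : R) => negLongMatrix a (algebraMap R (QuadExt R d) x)
  | .diff a b _, (x : QuadExt R d) => diffMatrix a b x
  | .posSum a b _, (x : QuadExt R d) => posSumMatrix a b x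
  | .negSum a b _, (x : QuadExt R d) => negSumMatrix a b x

lemma formMatrix_mul_single_zero {B : Type*} [CommRing B] (a : Fin n) (q : Idx n) (x : B) :
    formMatrix n B * Matrix.single (0, a) q x = Matrix.single (1, a) q x := by
  ext ⟨i, c⟩ r
  rcases eq_or_ne a c with rfl | hc
  · fin_cases i <;> by_cases hr : q = r <;>
      simp [formMatrix, Matrix.mul_apply, Matrix.single_apply, Matrix.blockDiagonal_apply, hr]
  · fin_cases i <;> by_cases hr : q = r <;>
      simp [formMatrix, Matrix.mul_apply, Matrix.single_apply, Matrix.blockDiagonal_apply, hr, hc,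
        hc.symm]

lemma formMatrix_mul_single_one {B : Type*} [CommRing B] (a : Fin n) (q : Idx n) (x : B) :
    formMatrix n B * Matrix.single (1, a) q x = -Matrix.single (0, a) q x := by
  ext ⟨i, c⟩ r
  rcases eq_or_ne a c with rfl | hc
  · fin_cases i <;> by_cases hr : q = r <;>
      simp [formMatrix, Matrix.mul_apply, Matrix.single_apply, Matrix.blockDiagonal_apply, hr]
  · fin_cases i <;> by_cases hr : q = r <;>
      simp [formMatrix, Matrix.mul_apply, Matrix.single_apply, Matrix.blockDiagonal_apply, hr, hc,
        hc.symm]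

lemma formMatrix_conjTranspose {B : Type*} [CommRing B] [StarRing B] :
    (formMatrix n B)ᴴ = -formMatrix n B := by
  ext ⟨i, a⟩ ⟨j, b⟩
  rcases eq_or_ne a b with h | h
  · subst h; fin_cases i <;> fin_cases j <;> simp [formMatrix, Matrix.blockDiagonal_apply]
  · simp [formMatrix, Matrix.blockDiagonal_apply, h, h.symm]

lemma star_algebraMap (x : R) :
    star (algebraMap R (QuadExt R d) x) = algebraMap R (QuadExt R d) x := by
  apply QuadraticAlgebra.ext
  · rw [QuadraticAlgebra.re_star, QuadraticAlgebra.algebraMap_im, mul_zero, add_zero]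
  · rw [QuadraticAlgebra.im_star, QuadraticAlgebra.algebraMap_im, neg_zero]

lemma form_invariant_of {B : Type*} [CommRing B] [StarRing B] (Y Z : Matrix (Idx n) (Idx n) B)
    (hZ : formMatrix n B * Y = Z) (h1 : Zᴴ = Z) (h2 : Z * Y = 0) :
    (1 + Y)ᴴ * formMatrix n B * (1 + Y) = formMatrix n B := by
  have h3 : Yᴴ * formMatrix n B = -Z := by
    rw [← h1, ← hZ, Matrix.conjTranspose_mul, formMatrix_conjTranspose, Matrix.mul_neg, neg_neg]
  rw [Matrix.conjTranspose_add, Matrix.conjTranspose_one, Matrix.add_mul, h3, Matrix.one_mul,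
    Matrix.mul_add, Matrix.mul_one, Matrix.add_mul, Matrix.neg_mul, h2, hZ]
  simp

lemma det_one_add_single {B : Type*} [CommRing B] {p q : Idx n} (h : p ≠ q) (x : B) :
    (1 + Matrix.single p q x).det = 1 :=
  Matrix.det_transvection_of_ne p q h x

lemma det_one_add_single_add {B : Type*} [CommRing B] {p q p' q' : Idx n} (h : p ≠ q)
    (h' : p' ≠ q') (hqp : q ≠ p') (x y : B) :
    (1 + Matrix.single p q x + Matrix.single p' q' y).det = 1 := by
  have : 1 + Matrix.single p q x + Matrix.single p' q' y
      = (1 + Matrix.single p q x) * (1 + Matrix.single p' q' y) := by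
    rw [Matrix.add_mul, Matrix.mul_add, Matrix.mul_add,
      Matrix.single_mul_single_of_ne (h := hqp)]
    simp only [Matrix.mul_one, Matrix.one_mul]; abel
  rw [this, Matrix.det_mul, det_one_add_single h, det_one_add_single h', one_mul]

lemma det_diffMatrix {B : Type*} [CommRing B] [StarRing B] {a b : Fin n} (h : a ≠ b) (x : B) :
    (diffMatrix a b x).det = 1 := by
  have h0 : ((0 : Fin 2), a) ≠ (0, b) := by simp [h]
  have h1 : ((1 : Fin 2), b) ≠ (1, a) := by simp [h.symm]
  have := det_one_add_single_add h0 h1 (by simp) x (-star x)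
  rwa [← Matrix.single_neg, ← sub_eq_add_neg] at this

lemma det_rootMatrix (α : Root n) (v : RootSpace d α R) : (rootMatrix α v).det = 1 := by
  cases α with
  | posLong a => exact det_one_add_single (by simp) _
  | negLong a => exact det_one_add_single (by simp) _
  | diff a b h => exact det_diffMatrix h _
  | posSum a b h => exact det_one_add_single_add (by simp) (by simp) (by simp) _ _
  | negSum a b h => exact det_one_add_single_add (by simp) (by simp) (by simp) _ _

lemma posLongMatrix_form {B : Type*} [CommRing B] [StarRing B] (a : Fin n) {x : B}
    (hx : star x = x) :
    (posLongMatrix a x)ᴴ * formMatrix n B * posLongMatrix a x = formMatrix n B := by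
  refine form_invariant_of _ _ (formMatrix_mul_single_zero _ _ _) ?_ ?_
  · rw [Matrix.conjTranspose_single, hx]
  · simp

lemma negLongMatrix_form {B : Type*} [CommRing B] [StarRing B] (a : Fin n) {x : B}
    (hx : star x = x) :
    (negLongMatrix a x)ᴴ * formMatrix n B * negLongMatrix a x = formMatrix n B := by
  refine form_invariant_of _ _ (formMatrix_mul_single_one _ _ _) ?_ ?_
  · rw [Matrix.conjTranspose_neg, Matrix.conjTranspose_single, hx]
  · simp

lemma diffMatrix_form {B : Type*} [CommRing B] [StarRing B] {a b : Fin n} (h : a ≠ b) (x : B) :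
    (diffMatrix a b x)ᴴ * formMatrix n B * diffMatrix a b x = formMatrix n B := by
  simp only [diffMatrix, add_sub_assoc]
  refine form_invariant_of _ (Matrix.single (1, a) (0, b) x + Matrix.single (0, b) (1, a) (star x))
    ?_ ?_ ?_
  · rw [Matrix.mul_sub, formMatrix_mul_single_zero, formMatrix_mul_single_one, sub_neg_eq_add]
  · simp [Matrix.conjTranspose_single, add_comm]
  · simp [Matrix.mul_sub, Matrix.add_mul, h, h.symm]

lemma posSumMatrix_form {B : Type*} [CommRing B] [StarRing B] (a b : Fin n) (x : B) :
    (posSumMatrix a b x)ᴴ * formMatrix n B * posSumMatrix a b x = formMatrix n B := by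
  simp only [posSumMatrix, add_assoc]
  refine form_invariant_of _ (Matrix.single (1, a) (1, b) x + Matrix.single (1, b) (1, a) (star x))
    ?_ ?_ ?_
  · rw [Matrix.mul_add, formMatrix_mul_single_zero, formMatrix_mul_single_zero]
  · simp [Matrix.conjTranspose_single, add_comm]
  · simp [Matrix.mul_add, Matrix.add_mul]

lemma negSumMatrix_form {B : Type*} [CommRing B] [StarRing B] (a b : Fin n) (x : B) :
    (negSumMatrix a b x)ᴴ * formMatrix n B * negSumMatrix a b x = formMatrix n B := by
  simp only [negSumMatrix, add_assoc]
  refine form_invariant_of _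
    (-Matrix.single (0, b) (0, a) x + -Matrix.single (0, a) (0, b) (star x)) ?_ ?_ ?_
  · rw [Matrix.mul_add, formMatrix_mul_single_one, formMatrix_mul_single_one]
  · simp [Matrix.conjTranspose_single, add_comm]
  · simp [Matrix.mul_add, Matrix.add_mul]

lemma rootMatrix_form (α : Root n) (v : RootSpace d α R) :
    (rootMatrix α v)ᴴ * formMatrix n _ * rootMatrix α v = formMatrix n _ := by
  cases α with
  | posLong a => exact posLongMatrix_form a (star_algebraMap _)
  | negLong a => exact negLongMatrix_form a (star_algebraMap _)
  | diff a b h => exact diffMatrix_form h _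
  | posSum a b h => exact posSumMatrix_form a b _
  | negSum a b h => exact negSumMatrix_form a b _

/-- The root element `X_α(v) ∈ G(R)`, for `v ∈ V_α(R)`. -/
def rootElt (α : Root n) (v : RootSpace d α R) : SU n R d :=
  ⟨⟨rootMatrix α v, det_rootMatrix α v⟩, rootMatrix_form α v⟩

lemma posLongMatrix_add {B : Type*} [CommRing B] (a : Fin n) (x y : B) :
    posLongMatrix a (x + y) = posLongMatrix a x * posLongMatrix a y := by
  simp [posLongMatrix, Matrix.single_add, Matrix.mul_add, Matrix.add_mul]; abel

lemma negLongMatrix_add {B : Type*} [CommRing B] (a : Fin n) (x y : B) :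
    negLongMatrix a (x + y) = negLongMatrix a x * negLongMatrix a y := by
  simp [negLongMatrix, Matrix.single_add, Matrix.mul_add, Matrix.add_mul]; abel

lemma diffMatrix_add {B : Type*} [CommRing B] [StarRing B] {a b : Fin n} (h : a ≠ b) (x y : B) :
    diffMatrix a b (x + y) = diffMatrix a b x * diffMatrix a b y := by
  simp [diffMatrix, Matrix.single_add, Matrix.mul_add, Matrix.add_mul, Matrix.mul_sub,
    Matrix.sub_mul, h, h.symm]
  abel

lemma posSumMatrix_add {B : Type*} [CommRing B] [StarRing B] (a b : Fin n) (x y : B) :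
    posSumMatrix a b (x + y) = posSumMatrix a b x * posSumMatrix a b y := by
  simp [posSumMatrix, Matrix.single_add, Matrix.mul_add, Matrix.add_mul]; abel

lemma negSumMatrix_add {B : Type*} [CommRing B] [StarRing B] (a b : Fin n) (x y : B) :
    negSumMatrix a b (x + y) = negSumMatrix a b x * negSumMatrix a b y := by
  simp [negSumMatrix, Matrix.single_add, Matrix.mul_add, Matrix.add_mul]; abel

lemma rootMatrix_add (α : Root n) (v w : RootSpace d α R) :
    rootMatrix α (v + w) = rootMatrix α v * rootMatrix α w := by
  cases α with
  | posLong a =>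
    exact (congrArg _ (map_add (algebraMap R (QuadExt R d)) v w)).trans (posLongMatrix_add a _ _)
  | negLong a =>
    exact (congrArg _ (map_add (algebraMap R (QuadExt R d)) v w)).trans (negLongMatrix_add a _ _)
  | diff a b h => exact diffMatrix_add h _ _
  | posSum a b h => exact posSumMatrix_add a b _ _
  | negSum a b h => exact negSumMatrix_add a b _ _

lemma rootElt_add (α : Root n) (v w : RootSpace d α R) :
    rootElt α (v + w) = rootElt α v * rootElt α w :=
  Subtype.ext (Subtype.ext (rootMatrix_add α v w))

lemma map_single_eq {B C : Type*} [CommRing B] [CommRing C] (g : B →+* C) (p q : Idx n) (x : B) :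
    g.mapMatrix (Matrix.single p q x) = Matrix.single p q (g x) := by
  simp

lemma map_posLongMatrix {B C : Type*} [CommRing B] [CommRing C] (g : B →+* C)
    (a : Fin n) (x : B) : g.mapMatrix (posLongMatrix a x) = posLongMatrix a (g x) := by
  rw [posLongMatrix, posLongMatrix, map_add, map_one, map_single_eq]

lemma map_negLongMatrix {B C : Type*} [CommRing B] [CommRing C] (g : B →+* C)
    (a : Fin n) (x : B) : g.mapMatrix (negLongMatrix a x) = negLongMatrix a (g x) := by
  rw [negLongMatrix, negLongMatrix, map_add, map_one, map_single_eq]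

lemma map_diffMatrix {B C : Type*} [CommRing B] [StarRing B] [CommRing C] [StarRing C] (g : B →+* C) (hg : ∀ z, g (star z) = star (g z))
    (a b : Fin n) (x : B) : g.mapMatrix (diffMatrix a b x) = diffMatrix a b (g x) := by
  rw [diffMatrix, diffMatrix, map_sub, map_add, map_one, map_single_eq, map_single_eq, hg]

lemma map_posSumMatrix {B C : Type*} [CommRing B] [StarRing B] [CommRing C] [StarRing C] (g : B →+* C) (hg : ∀ z, g (star z) = star (g z))
    (a b : Fin n) (x : B) : g.mapMatrix (posSumMatrix a b x) = posSumMatrix a b (g x) := by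
  rw [posSumMatrix, posSumMatrix, map_add, map_add, map_one, map_single_eq, map_single_eq, hg]

lemma map_negSumMatrix {B C : Type*} [CommRing B] [StarRing B] [CommRing C] [StarRing C] (g : B →+* C) (hg : ∀ z, g (star z) = star (g z))
    (a b : Fin n) (x : B) : g.mapMatrix (negSumMatrix a b x) = negSumMatrix a b (g x) := by
  rw [negSumMatrix, negSumMatrix, map_add, map_add, map_one, map_single_eq, map_single_eq, hg]

lemma QuadExt.map_algebraMap (g : R →ₐ[k] S) (x : R) :
    QuadExt.map d g (algebraMap R (QuadExt R d) x) = algebraMap S (QuadExt S d) (g x) :=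
  QuadraticAlgebra.ext rfl (map_zero g)

lemma rootMatrix_map (g : R →ₐ[k] S) (α : Root n) (v : RootSpace d α R) :
    rootMatrix α (RootSpace.map d α g v) = (QuadExt.map d g).mapMatrix (rootMatrix α v) := by
  symm
  cases α with
  | posLong a =>
    exact (map_posLongMatrix _ a _).trans (congrArg _ (QuadExt.map_algebraMap g v))
  | negLong a =>
    exact (map_negLongMatrix _ a _).trans (congrArg _ (QuadExt.map_algebraMap g v))
  | diff a b h => exact map_diffMatrix _ (QuadExt.map_star d g) a b _
  | posSum a b h => exact map_posSumMatrix _ (QuadExt.map_star d g) a b _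
  | negSum a b h => exact map_negSumMatrix _ (QuadExt.map_star d g) a b _

lemma rootElt_map (g : R →ₐ[k] S) (α : Root n) (v : RootSpace d α R) :
    (rootElt α (RootSpace.map d α g v)).1
      = Matrix.SpecialLinearGroup.map (QuadExt.map d g) (rootElt α v).1 :=
  Subtype.ext (rootMatrix_map g α v)

end RootElements

/-- `l` lists, without repetition, the roots of the form `iα + jβ` with integers `i, j ≥ 1`. -/
def IsRootList {n : ℕ} (α β : Root n) (l : List (Root n)) : Prop :=
  l.Nodup ∧ ∀ γ : Root n, γ ∈ l ↔
    ∃ i j : ℕ, 1 ≤ i ∧ 1 ≤ j ∧ γ.toChar = i • α.toChar + j • β.toChar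

/-- The symbol `X̃_α(v)`, as an element of the free group on all symbols `X̃_α(v)`,
for roots `α` and `v ∈ V_α(R)`. -/
def symb {k : Type*} [Field k] {n : ℕ} {R : Type*} [CommRing R] [Algebra k R] {d : k}
    (α : Root n) (v : RootSpace d α R) : FreeGroup (Σ α : Root n, RootSpace d α R) :=
  FreeGroup.of ⟨α, v⟩

/-- The defining relations of the Steinberg group, in the free group on the symbols `X̃_α(v)`,
for roots `α` and `v ∈ V_α(R)`. In the second family, the `w_γ` are the values
`N_{ij}^{αβ}(u, v)`, `γ = iα + jβ`, of the polynomial maps in the Chevalley commutator formula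
of `G`: they are determined by `u`, `v` and that formula, the equation in `G(R)` below.
The factors of the product commute, so their order does not matter. -/
inductive steinbergRel {k : Type*} [Field k] (n : ℕ) (R : Type*) [CommRing R] [Algebra k R]
    (d : k) : FreeGroup (Σ α : Root n, RootSpace d α R) → Prop
  | add (α : Root n) (v w : RootSpace d α R) :
      steinbergRel n R d
        (symb α v * symb α w * (symb α (v + w))⁻¹)
  | comm (α β : Root n) (h : α.toChar ≠ β.toChar) (h' : α.toChar ≠ -β.toChar)
      (u : RootSpace d α R) (v : RootSpace d β R)
      (l : List (Root n)) (hl : IsRootList α β l) (w : ∀ γ : Root n, RootSpace d γ R)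
      (hw : ⁅rootElt α u, rootElt β v⁆ = (l.map fun γ => rootElt γ (w γ)).prod) :
      steinbergRel n R d
        (⁅symb α u, symb β v⁆ * ((l.map fun γ => symb γ (w γ)).prod)⁻¹)

/-- The Steinberg group `G̃(R)`. -/
def Steinberg {k : Type*} [Field k] (n : ℕ) (R : Type*) [CommRing R] [Algebra k R] (d : k) :
    Type _ :=
  PresentedGroup {r | steinbergRel n R d r}

namespace Steinberg

variable {k : Type*} [Field k] {n : ℕ} {R S : Type*} [CommRing R] [Algebra k R]
  [CommRing S] [Algebra k S] {d : k}

instance : Group (Steinberg n R d) :=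
  inferInstanceAs (Group (PresentedGroup {r | steinbergRel n R d r}))

/-- The generator `X̃_α(v)` of `G̃(R)`. -/
def X (α : Root n) (v : RootSpace d α R) : Steinberg n R d :=
  PresentedGroup.of (rels := {r | steinbergRel n R d r}) ⟨α, v⟩

/-- A family of elements that satisfies the Steinberg relations defines a homomorphism. -/
def lift {Γ : Type*} [Group Γ] (Y : ∀ α : Root n, RootSpace d α R → Γ)
    (hadd : ∀ α v w, Y α v * Y α w = Y α (v + w))
    (hcomm : ∀ α β : Root n, α.toChar ≠ β.toChar → α.toChar ≠ -β.toChar →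
      ∀ (u : RootSpace d α R) (v : RootSpace d β R) (l : List (Root n)), IsRootList α β l →
      ∀ w : ∀ γ : Root n, RootSpace d γ R,
        ⁅rootElt α u, rootElt β v⁆ = (l.map fun γ => rootElt γ (w γ)).prod →
        ⁅Y α u, Y β v⁆ = (l.map fun γ => Y γ (w γ)).prod) :
    Steinberg n R d →* Γ :=
  PresentedGroup.toGroup (rels := {r | steinbergRel n R d r}) (f := fun x => Y x.1 x.2) (by
    rintro r (⟨α, v, w⟩ | ⟨α, β, h, h', u, v, l, hl, w, hw⟩)
    · simp [symb, hadd]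
    · have := hcomm α β h h' u v l hl w hw
      simp only [map_mul, map_inv, map_commutatorElement, symb, FreeGroup.lift_apply_of, map_list_prod,
        List.map_map, Function.comp_def]
      rw [this, mul_inv_cancel])

/-- The natural homomorphism `π_R : G̃(R) → G(R)`, `X̃_α(v) ↦ X_α(v)`. -/
def toSU : Steinberg n R d →* SU n R d :=
  lift rootElt (fun α v w => (rootElt_add α v w).symm) (fun _ _ _ _ _ _ _ _ _ hw => hw)

lemma X_mul (α : Root n) (v w : RootSpace d α R) : X α v * X α w = X α (v + w) := by
  have h := PresentedGroup.one_of_mem (rels := {r | steinbergRel n R d r})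
    (steinbergRel.add α v w)
  rw [map_mul, map_inv, mul_inv_eq_one, map_mul] at h
  exact h

lemma commutator_X (α β : Root n) (h : α.toChar ≠ β.toChar) (h' : α.toChar ≠ -β.toChar)
    (u : RootSpace d α R) (v : RootSpace d β R) (l : List (Root n)) (hl : IsRootList α β l)
    (w : ∀ γ : Root n, RootSpace d γ R)
    (hw : ⁅rootElt α u, rootElt β v⁆ = (l.map fun γ => rootElt γ (w γ)).prod) :
    ⁅X α u, X β v⁆ = (l.map fun γ => X γ (w γ)).prod := by
  have h := PresentedGroup.one_of_mem (rels := {r | steinbergRel n R d r})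
    (steinbergRel.comm α β h h' u v l hl w hw)
  rw [map_mul, map_inv, mul_inv_eq_one, map_commutatorElement, map_list_prod, List.map_map] at h
  exact h

/-- The homomorphism `G̃(R) → G̃(S)`, `X̃_α(v) ↦ X̃_α(V_α(g)(v))`, induced by `g : R → S`. -/
def map (g : R →ₐ[k] S) : Steinberg n R d →* Steinberg n S d :=
  lift (fun α v => X α (RootSpace.map d α g v))
    (fun α v w => by rw [X_mul, map_add])
    (fun α β h h' u v l hl w hw => by
      refine commutator_X α β h h' _ _ l hl (fun γ => RootSpace.map d γ g (w γ)) ?_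
      have := congrArg (fun x : SU n R d =>
        Matrix.SpecialLinearGroup.map (QuadExt.map d g) x.1) hw
      apply Subtype.ext
      have h2 : ∀ l : List (Root n),
          ((l.map fun γ => rootElt γ (RootSpace.map d γ g (w γ))).prod).1
          = Matrix.SpecialLinearGroup.map (QuadExt.map d g)
            ((l.map fun γ => rootElt γ (w γ)).prod).1 := by
        intro l
        induction l with
        | nil => simp
        | cons γ l ih => simp only [List.map_cons, List.prod_cons, Subgroup.coe_mul, map_mul, ih,
            rootElt_map]
      rw [h2, ← this]
      simp only [commutatorElement_def, Subgroup.coe_mul, Subgroup.coe_inv, map_mul, map_inv,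
        rootElt_map])

end Steinberg

section Zariski

variable (K : Type*) [Field K]

/-- The regular functions on a finite-dimensional `K`-vector space `V`, viewed as an affine space:
the polynomial functions, i.e. the `K`-algebra of functions generated by the linear forms. -/
def regularFun (V : Type*) [AddCommGroup V] [Module K V] : Subalgebra K (V → K) :=
  Algebra.adjoin K (Set.range fun l : Module.Dual K V => (l : V → K))

/-- `s` is Zariski-dense in the affine space `V`. -/
def IsZariskiDense {V : Type*} [AddCommGroup V] [Module K V] (s : Set V) : Prop :=
  ∀ φ ∈ regularFun K V, (∀ x ∈ s, φ x = 0) → ∀ x, φ x = 0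

/-- The regular functions on the algebraic group `GL_m`: the `K`-algebra of functions generated by
the entries of a matrix and of its inverse. -/
def regularFunGL (m : ℕ) : Subalgebra K (GL (Fin m) K → K) :=
  Algebra.adjoin K
    ((Set.range fun p : Fin m × Fin m => fun g : GL (Fin m) K => (g : Matrix _ _ K) p.1 p.2) ∪
      (Set.range fun p : Fin m × Fin m => fun g : GL (Fin m) K =>
        ((g⁻¹ : GL (Fin m) K) : Matrix _ _ K) p.1 p.2))

variable {K}

lemma regularFunGL_comp {m : ℕ} {t : GL (Fin m) K → GL (Fin m) K}
    (h1 : ∀ i j, (fun g => (t g).1 i j) ∈ regularFunGL K m)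
    (h2 : ∀ i j, (fun g => ((t g)⁻¹ : GL (Fin m) K).1 i j) ∈ regularFunGL K m)
    {φ : GL (Fin m) K → K} (hφ : φ ∈ regularFunGL K m) :
    (fun g => φ (t g)) ∈ regularFunGL K m := by
  induction hφ using Algebra.adjoin_induction with
  | mem x hx =>
    rcases hx with ⟨p, rfl⟩ | ⟨p, rfl⟩
    · exact h1 _ _
    · exact h2 _ _
  | algebraMap r => exact (regularFunGL K m).algebraMap_mem r
  | add x y _ _ hx hy => exact (regularFunGL K m).add_mem hx hy
  | mul x y _ _ hx hy => exact (regularFunGL K m).mul_mem hx hy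

lemma entry_mem_regularFunGL {m : ℕ} (i j : Fin m) :
    (fun g : GL (Fin m) K => (g : Matrix _ _ K) i j) ∈ regularFunGL K m :=
  Algebra.subset_adjoin (Or.inl ⟨(i, j), rfl⟩)

lemma inv_entry_mem_regularFunGL {m : ℕ} (i j : Fin m) :
    (fun g : GL (Fin m) K => (g⁻¹ : GL (Fin m) K).1 i j) ∈ regularFunGL K m :=
  Algebra.subset_adjoin (Or.inr ⟨(i, j), rfl⟩)

lemma sum_mem_regularFunGL {m : ℕ} (a b : Fin m → GL (Fin m) K → K)
    (ha : ∀ l, a l ∈ regularFunGL K m) (hb : ∀ l, b l ∈ regularFunGL K m) :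
    (fun g => ∑ l, a l g * b l g) ∈ regularFunGL K m := by
  have : (fun g => ∑ l, a l g * b l g) = ∑ l, a l * b l := by
    ext g; simp
  rw [this]
  exact Subalgebra.sum_mem _ fun l _ => Subalgebra.mul_mem _ (ha l) (hb l)

lemma const_mem_regularFunGL {m : ℕ} (c : K) :
    (fun _ : GL (Fin m) K => c) ∈ regularFunGL K m :=
  (regularFunGL K m).algebraMap_mem c

/-- The Zariski closure in `GL_m(K)` of a subgroup, as a subgroup: the set of common zeros of all
regular functions on `GL_m` that vanish on the given subgroup. -/
def zariskiClosure {m : ℕ} (Γ : Subgroup (GL (Fin m) K)) : Subgroup (GL (Fin m) K) where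
  carrier := {g | ∀ φ ∈ regularFunGL K m, (∀ x ∈ Γ, φ x = 0) → φ g = 0}
  one_mem' φ _ h := h 1 Γ.one_mem
  mul_mem' {g g'} hg hg' φ hφ h := by
    refine hg (fun y => φ (y * g')) (regularFunGL_comp (t := fun y => y * g') ?_ ?_ hφ) ?_
    · intro i j
      simp only [Units.val_mul, Matrix.mul_apply]
      exact sum_mem_regularFunGL _ _ (fun l => entry_mem_regularFunGL i l)
        fun l => const_mem_regularFunGL _
    · intro i j
      simp only [mul_inv_rev, Units.val_mul, Matrix.mul_apply]
      exact sum_mem_regularFunGL _ _ (fun l => const_mem_regularFunGL _)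
        fun l => inv_entry_mem_regularFunGL l j
    · intro x hx
      refine hg' (fun y => φ (x * y)) (regularFunGL_comp (t := fun y => x * y) ?_ ?_ hφ)
        fun y hy => h _ (Γ.mul_mem hx hy)
      · intro i j
        simp only [Units.val_mul, Matrix.mul_apply]
        exact sum_mem_regularFunGL _ _ (fun l => const_mem_regularFunGL _)
          fun l => entry_mem_regularFunGL l j
      · intro i j
        simp only [mul_inv_rev, Units.val_mul, Matrix.mul_apply]
        exact sum_mem_regularFunGL _ _ (fun l => inv_entry_mem_regularFunGL i l)
          fun l => const_mem_regularFunGL _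
  inv_mem' {g} hg φ hφ h := by
    refine hg (fun y => φ y⁻¹) (regularFunGL_comp (t := fun y => y⁻¹) ?_ ?_ hφ)
      fun x hx => h _ (Γ.inv_mem hx)
    · exact fun i j => inv_entry_mem_regularFunGL i j
    · intro i j
      simpa only [inv_inv] using entry_mem_regularFunGL i j

/-- A map from the affine space `V` to a closed subgroup `H` of `GL_m` is regular if it pulls
regular functions back to regular functions. -/
def IsRegularMap {V : Type*} [AddCommGroup V] [Module K V] {m : ℕ} {H : Subgroup (GL (Fin m) K)}
    (ψ : V → H) : Prop :=
  ∀ φ ∈ regularFunGL K m, (fun v => φ (ψ v : GL (Fin m) K)) ∈ regularFun K V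

end Zariski

end QuasiSplitSU

end

/-!
The homomorphism `σ` is forced on the generators to be `X̃_α(v) ↦ ψ_α(v)`, so the point is that the
`ψ_α` satisfy the Steinberg relations. On the image of `k` they do, since there `ψ_α` is `ρ ∘ X_α`
and the relations hold in `G(k)`. Both sides of each relation are regular maps of the parameters
`(u, v) ∈ V_α(A) × V_β(A)`, and `V_α(k) × V_β(k)` is Zariski-dense there, so the relations hold over
`A` (`regular_extension_add`, `regular_extension_commutator`).

This argument needs that the parameters `N_{ij}^{αβ}(u, v)` of the Chevalley commutator formula
exist over `k`, are unique over `A`, and are given over both by the same polynomials. All of this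
comes from weights rather than from a case analysis over pairs of roots. Write
`X_α(u) = 1 + Y` and `X_β(v) = 1 + Z`, where `Y` and `Z` have square zero and are homogeneous of
weights `α` and `β` for the conjugation action of the torus. Then `⁅X_α(u), X_β(v)⁆ = 1 + N` with
all entries of `N` in weights `iα + jβ`, `i, j ≥ 1`. In type `C_n` a combination `iα + jβ` with
`i, j ≥ 2` is too long to be the weight of a matrix position (`Root.le_dotProduct_comb`). Therefore
`N² = 0`, so that `N` lies in the Lie algebra of `G`, and it is the sum of its components in the
root spaces of the roots `iα + jβ`. For the same reason the product of root elements for these roots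
is `1` plus the sum of their nilpotent parts. Comparing the two, the parameters exist over `k`
(`commutator_rootElt`) and must be the coordinates of `N` over any `A` (`eq_coord_commNil`), and
these are polynomial in `(u, v)`.
-/

noncomputable section

namespace QuasiSplitSU

/-! ### Regular functions and regular maps -/

section Regular

variable {K : Type*} [Field K] {P V W B : Type*} [AddCommGroup P] [Module K P]
  [AddCommGroup V] [Module K V] [AddCommGroup W] [Module K W] [Ring B] [Algebra K B]

variable (K) in
/-- A polynomial map between vector spaces: its composition with each linear form is regular. -/
def IsPolyMap (F : P → W) : Prop :=
  ∀ l : Module.Dual K W, (fun x => l (F x)) ∈ regularFun K P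

lemma dual_mem_regularFun (l : Module.Dual K P) : (fun x => l x) ∈ regularFun K P :=
  Algebra.subset_adjoin ⟨l, rfl⟩

lemma LinearMap.isPolyMap (L : P →ₗ[K] W) : IsPolyMap K L :=
  fun l => dual_mem_regularFun (l ∘ₗ L)

namespace IsPolyMap

lemma const (w : W) : IsPolyMap K (fun _ : P => w) :=
  fun l => (regularFun K P).algebraMap_mem (l w)

lemma add {F G : P → W} (hF : IsPolyMap K F) (hG : IsPolyMap K G) :
    IsPolyMap K (fun x => F x + G x) := fun l => by
  simpa only [map_add] using! (regularFun K P).add_mem (hF l) (hG l)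

lemma linear_comp (L : V →ₗ[K] W) {F : P → V} (hF : IsPolyMap K F) :
    IsPolyMap K (fun x => L (F x)) := fun l => hF (l ∘ₗ L)

/-- Expanding in a basis of `B`, the linear forms of a product are bilinear in the coordinates
of the factors. -/
lemma mul [Module.Finite K B] {F G : P → B} (hF : IsPolyMap K F) (hG : IsPolyMap K G) :
    IsPolyMap K (fun x => F x * G x) := fun l => by
  let b := Module.finBasis K B
  have h : (fun x => l (F x * G x)) = ∑ i, ∑ j,
      (fun x => b.coord i (F x)) * (fun x => b.coord j (G x)) * fun _ => l (b i * b j) := by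
    ext x
    conv_lhs => rw [← b.sum_repr (F x), ← b.sum_repr (G x)]
    simp only [Finset.sum_mul_sum, map_sum, Finset.sum_apply, Pi.mul_apply, smul_mul_smul_comm,
      map_smul, smul_eq_mul, Module.Basis.coord_apply]
  rw [h]
  exact Subalgebra.sum_mem _ fun i _ => Subalgebra.sum_mem _ fun j _ =>
    Subalgebra.mul_mem _ (Subalgebra.mul_mem _ (hF _) (hG _))
      ((regularFun K P).algebraMap_mem (l (b i * b j)))

lemma comp_mem_regularFun {F : P → W} (hF : IsPolyMap K F) {φ : W → K}
    (hφ : φ ∈ regularFun K W) : (fun x => φ (F x)) ∈ regularFun K P := by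
  induction hφ using Algebra.adjoin_induction with
  | mem _ hx => obtain ⟨l, rfl⟩ := hx; exact hF l
  | algebraMap r => exact (regularFun K P).algebraMap_mem r
  | add _ _ _ _ hx hy => exact (regularFun K P).add_mem hx hy
  | mul _ _ _ _ hx hy => exact (regularFun K P).mul_mem hx hy

end IsPolyMap

/-- The image of a Zariski-dense set under a surjective linear map is Zariski-dense. -/
lemma IsZariskiDense.image {s : Set V} (hs : IsZariskiDense K s) (L : V →ₗ[K] W)
    (hL : Function.Surjective L) : IsZariskiDense K (L '' s) := by
  intro φ hφ h y
  obtain ⟨x, rfl⟩ := hL y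
  exact hs _ ((LinearMap.isPolyMap L).comp_mem_regularFun hφ) (fun z hz => h _ ⟨z, hz, rfl⟩) x

lemma IsZariskiDense.prod {s : Set V} {t : Set W} (hs : IsZariskiDense K s)
    (ht : IsZariskiDense K t) : IsZariskiDense K (s ×ˢ t) := by
  intro φ hφ h
  have hfix1 (x : V) : IsPolyMap K (fun y : W => (x, y)) := by
    simpa using! (IsPolyMap.const (x, (0 : W))).add (LinearMap.isPolyMap (LinearMap.inr K V W))
  have hfix2 (y : W) : IsPolyMap K (fun x : V => (x, y)) := by
    simpa using! (LinearMap.isPolyMap (LinearMap.inl K V W)).add (IsPolyMap.const ((0 : V), y))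
  have h1 : ∀ x ∈ s, ∀ y, φ (x, y) = 0 := fun x hx =>
    ht _ ((hfix1 x).comp_mem_regularFun hφ) fun y hy => h _ ⟨hx, hy⟩
  rintro ⟨x, y⟩
  exact hs _ ((hfix2 y).comp_mem_regularFun hφ) (fun x hx => h1 x hx y) x

variable (K P) in
/-- The group of regular maps from an affine space `P` to `GL_m`, under pointwise multiplication. -/
def regularMaps (m : ℕ) : Subgroup (P → GL (Fin m) K) where
  carrier := {F | ∀ φ ∈ regularFunGL K m, (fun x => φ (F x)) ∈ regularFun K P}
  one_mem' φ _ := (regularFun K P).algebraMap_mem (φ 1)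
  mul_mem' {F G} hF hG φ hφ := by
    have hsum (a b : Fin m → P → K) (ha : ∀ l, a l ∈ regularFun K P)
        (hb : ∀ l, b l ∈ regularFun K P) : (fun x => ∑ l, a l x * b l x) ∈ regularFun K P := by
      have : (fun x => ∑ l, a l x * b l x) = ∑ l, a l * b l := by ext; simp
      rw [this]
      exact Subalgebra.sum_mem _ fun l _ => Subalgebra.mul_mem _ (ha l) (hb l)
    induction hφ using Algebra.adjoin_induction with
    | mem _ hx =>
      rcases hx with ⟨p, rfl⟩ | ⟨p, rfl⟩
      · simp only [Pi.mul_apply, Units.val_mul, Matrix.mul_apply]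
        exact hsum _ _ (fun l => hF _ (entry_mem_regularFunGL p.1 l))
          fun l => hG _ (entry_mem_regularFunGL l p.2)
      · simp only [Pi.mul_apply, mul_inv_rev, Units.val_mul, Matrix.mul_apply]
        exact hsum _ _ (fun l => hG _ (inv_entry_mem_regularFunGL p.1 l))
          fun l => hF _ (inv_entry_mem_regularFunGL l p.2)
    | algebraMap r => exact (regularFun K P).algebraMap_mem r
    | add _ _ _ _ hx hy => exact (regularFun K P).add_mem hx hy
    | mul _ _ _ _ hx hy => exact (regularFun K P).mul_mem hx hy
  inv_mem' {F} hF φ hφ := hF (fun g => φ g⁻¹) <| regularFunGL_comp (t := fun g => g⁻¹)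
    (fun i j => inv_entry_mem_regularFunGL i j)
    (fun i j => by simpa only [inv_inv] using entry_mem_regularFunGL i j) hφ

/-- Regular maps into `GL_m` that agree on a Zariski-dense set are equal. -/
lemma IsZariskiDense.eq_of_mem_regularMaps {s : Set P} (hs : IsZariskiDense K s) {m : ℕ}
    {F G : P → GL (Fin m) K} (hF : F ∈ regularMaps K P m) (hG : G ∈ regularMaps K P m)
    (h : ∀ x ∈ s, F x = G x) : F = G := by
  ext x i j
  refine sub_eq_zero.mp (hs _ ((regularFun K P).sub_mem (hF _ (entry_mem_regularFunGL i j))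
    (hG _ (entry_mem_regularFunGL i j))) (fun y hy => ?_) x)
  simp [h y hy]

lemma IsRegularMap.comp_mem_regularMaps {m : ℕ} {H : Subgroup (GL (Fin m) K)} {ψ : W → H}
    (hψ : IsRegularMap ψ) {F : P → W} (hF : IsPolyMap K F) :
    (fun x => (ψ (F x) : GL (Fin m) K)) ∈ regularMaps K P m :=
  fun φ hφ => hF.comp_mem_regularFun (hψ φ hφ)

end Regular

/-! ### Weights of matrix positions -/

section Weights

variable {n : ℕ}

/-- The character by which the torus acts on the basis vector `p`: `ε_a` for `p = (0, a)` and
`-ε_a` for `p = (1, a)`. -/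
def wt (p : Idx n) : Fin n → ℤ :=
  if p.1 = 0 then Pi.single p.2 1 else -Pi.single p.2 1

@[simp] lemma wt_zero (a : Fin n) : wt (0, a) = Pi.single a 1 := by simp [wt]

@[simp] lemma wt_one (a : Fin n) : wt (1, a) = -Pi.single a 1 := by simp [wt]

lemma dotProduct_wt_sub_le (p q : Idx n) : (wt p - wt q) ⬝ᵥ (wt p - wt q) ≤ 4 := by
  obtain ⟨i, a⟩ := p
  obtain ⟨j, b⟩ := q
  rcases eq_or_ne a b with rfl | hab
  · fin_cases i <;> fin_cases j <;> simp
  · fin_cases i <;> fin_cases j <;> simp [hab, hab.symm]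

/-- A root has squared length `2`, or it is twice a character and has squared length `4`. -/
lemma Root.dotProduct_self (α : Root n) : α.toChar ⬝ᵥ α.toChar = 2 ∨
    α.toChar ⬝ᵥ α.toChar = 4 ∧ ∃ x, α.toChar = (2 : ℤ) • x := by
  cases α with
  | posLong a => exact .inr ⟨by
      simp only [toChar, smul_dotProduct, dotProduct_smul]; simp, Pi.single a 1, by simp [toChar]⟩
  | negLong a => exact .inr ⟨by
      simp only [toChar, neg_dotProduct, dotProduct_neg, smul_dotProduct, dotProduct_smul]; simp,
      -Pi.single a 1, by simp [toChar]⟩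
  | diff a b h => left; simp [toChar, h, h.symm]
  | posSum a b h => left; simp [toChar, h.ne, h.ne']
  | negSum a b h => left; simp [toChar, h.ne, h.ne']

/-- In a root system of type `C_n`, a combination of `α ≠ -β` with large coefficients is long,
because the angle between `α` and `β` is at most `135°`. -/
lemma Root.le_dotProduct_comb {α β : Root n} (h : α.toChar ≠ -β.toChar) {m i j : ℕ}
    (hi : m ≤ i) (hj : m ≤ j) : 2 * (m : ℤ) ^ 2 ≤
      (i • α.toChar + j • β.toChar) ⬝ᵥ (i • α.toChar + j • β.toChar) := by
  have hpos : 0 < (α.toChar + β.toChar) ⬝ᵥ (α.toChar + β.toChar) := by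
    have h0 : α.toChar + β.toChar ≠ 0 := fun h0 => h (eq_neg_of_add_eq_zero_left h0)
    refine lt_of_le_of_ne (Finset.sum_nonneg fun _ _ => mul_self_nonneg _) (Ne.symm ?_)
    rwa [Ne, dotProduct_self_eq_zero]
  have hi' : (m : ℤ) ≤ i := by exact_mod_cast hi
  have hj' : (m : ℤ) ≤ j := by exact_mod_cast hj
  have hm : (0 : ℤ) ≤ m := m.cast_nonneg
  have hij : (0 : ℤ) ≤ i * j := by positivity
  have hii : (m : ℤ) ^ 2 ≤ (i : ℤ) ^ 2 := by gcongr
  have hjj : (m : ℤ) ^ 2 ≤ (j : ℤ) ^ 2 := by gcongr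
  have expand : (i • α.toChar + j • β.toChar) ⬝ᵥ (i • α.toChar + j • β.toChar)
      = (i : ℤ) ^ 2 * (α.toChar ⬝ᵥ α.toChar) + (j : ℤ) ^ 2 * (β.toChar ⬝ᵥ β.toChar)
        + 2 * (i * j) * (α.toChar ⬝ᵥ β.toChar) := by
    simp only [add_dotProduct, dotProduct_add, smul_dotProduct, dotProduct_smul,
      dotProduct_comm β.toChar α.toChar, ← natCast_zsmul, smul_eq_mul]
    ring
  simp only [add_dotProduct, dotProduct_add, dotProduct_comm β.toChar α.toChar] at hpos
  rw [expand]
  -- Products with a long root are even, which sharpens `hpos`.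
  rcases α.dotProduct_self with hα | ⟨hα, x, hx⟩ <;>
    rcases β.dotProduct_self with hβ | ⟨hβ, y, hy⟩ <;> rw [hα, hβ] at hpos ⊢
  · have hc : -1 ≤ α.toChar ⬝ᵥ β.toChar := by omega
    nlinarith [mul_le_mul_of_nonneg_left hc hij, sq_nonneg ((i : ℤ) - j)]
  · have hc : -2 ≤ α.toChar ⬝ᵥ β.toChar := by
      rw [hy, dotProduct_smul, smul_eq_mul] at hpos ⊢; omega
    nlinarith [mul_le_mul_of_nonneg_left hc hij, sq_nonneg ((i : ℤ) - j)]
  · have hc : -2 ≤ α.toChar ⬝ᵥ β.toChar := by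
      rw [hx, smul_dotProduct, smul_eq_mul] at hpos ⊢; omega
    nlinarith [mul_le_mul_of_nonneg_left hc hij, sq_nonneg ((i : ℤ) - j)]
  · have hc : -2 ≤ α.toChar ⬝ᵥ β.toChar := by
      rw [hy, dotProduct_smul, smul_eq_mul] at hpos ⊢; omega
    nlinarith [mul_le_mul_of_nonneg_left hc hij, sq_nonneg ((i : ℤ) - j)]

lemma Root.comb_ne_zero {α β : Root n} (h : α.toChar ≠ -β.toChar) {i j : ℕ}
    (hi : 1 ≤ i) (hj : 1 ≤ j) : i • α.toChar + j • β.toChar ≠ 0 := fun h0 => by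
  have := le_dotProduct_comb h hi hj
  rw [h0] at this
  simp at this

lemma Root.comb_ne_wt_sub {α β : Root n} (h : α.toChar ≠ -β.toChar) {i j : ℕ}
    (hi : 2 ≤ i) (hj : 2 ≤ j) (p q : Idx n) :
    wt p - wt q ≠ i • α.toChar + j • β.toChar := fun h0 => by
  have h1 := le_dotProduct_comb h hi hj
  have h2 := dotProduct_wt_sub_le p q
  rw [← h0] at h1
  have h3 := h1.trans h2
  norm_num at h3

lemma Root.exists_toChar_eq {p q : Idx n} (h : p ≠ q) : ∃ γ : Root n, γ.toChar = wt p - wt q := by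
  obtain ⟨i, a⟩ := p
  obtain ⟨j, b⟩ := q
  rcases lt_trichotomy a b with hab | rfl | hab
  · fin_cases i <;> fin_cases j
    · exact ⟨.diff a b hab.ne, by simp [toChar]⟩
    · exact ⟨.posSum a b hab, by simp [toChar]⟩
    · exact ⟨.negSum a b hab, by simp [toChar]; abel⟩
    · exact ⟨.diff b a hab.ne', by simp [toChar]; abel⟩
  · fin_cases i <;> fin_cases j
    · simp at h
    · exact ⟨.posLong a, by simp [toChar, two_mul]⟩
    · exact ⟨.negLong a, by simp [toChar, two_mul]; abel⟩
    · simp at h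
  · fin_cases i <;> fin_cases j
    · exact ⟨.diff a b hab.ne', by simp [toChar]⟩
    · exact ⟨.posSum b a hab, by simp [toChar, add_comm]⟩
    · exact ⟨.negSum b a hab, by simp [toChar]; abel⟩
    · exact ⟨.diff b a hab.ne, by simp [toChar]; abel⟩

/-- The dual index: `(0, a)` and `(1, a)` are exchanged, so that the weight changes sign. -/
def dual (p : Idx n) : Idx n := (1 - p.1, p.2)

/-- A root determines a position in a matrix up to the reflection `(p, q) ↦ (q', p')`. -/
lemma wt_sub_eq {p q r s : Idx n} (hpq : p ≠ q) (h : wt p - wt q = wt r - wt s) :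
    (r = p ∧ s = q) ∨ (r = dual q ∧ s = dual p) := by
  obtain ⟨i, a⟩ := p
  obtain ⟨j, b⟩ := q
  obtain ⟨i', a'⟩ := r
  obtain ⟨j', b'⟩ := s
  have h1 := congrFun h a
  have h2 := congrFun h b
  have h3 := congrFun h a'
  have h4 := congrFun h b'
  fin_cases i <;> fin_cases j <;> fin_cases i' <;> fin_cases j' <;>
    simp [Pi.single_apply, dual] at h1 h2 h3 h4 hpq ⊢ <;> grind

end Weights

/-! ### Root elements and their coordinates -/

section RootCoordinates

variable {k : Type*} [Field k] {n : ℕ} {R S : Type*} [CommRing R] [Algebra k R]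
  [CommRing S] [Algebra k S] {d : k}

/-- The position of the coordinate of the root subgroup of `α`. -/
def Root.pos : Root n → Idx n × Idx n
  | .posLong a => ((0, a), (1, a))
  | .negLong a => ((1, a), (0, a))
  | .diff a b _ => ((0, a), (0, b))
  | .posSum a b _ => ((0, a), (1, b))
  | .negSum a b _ => ((1, b), (0, a))

lemma Root.toChar_eq (α : Root n) : α.toChar = wt α.pos.1 - wt α.pos.2 := by
  cases α <;> simp [toChar, pos, two_mul] <;> abel

lemma Root.pos_ne (α : Root n) : α.pos.1 ≠ α.pos.2 := by
  cases α <;> simp [pos, *]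

lemma Root.toChar_injective : Function.Injective (toChar (n := n)) := by
  intro α β h
  rw [toChar_eq, toChar_eq] at h
  have := wt_sub_eq α.pos_ne h
  cases α <;> cases β <;> simp [pos, dual] at this ⊢ <;> grind

/-- The coordinate of a matrix that belongs to the root `α`: the entry at the position of `α`,
or its rational part if `α` is long. -/
def coord : (α : Root n) → Matrix (Idx n) (Idx n) (QuadExt R d) → RootSpace d α R
  | .posLong a, M => (M (0, a) (1, a)).re
  | .negLong a, M => (M (1, a) (0, a)).re
  | .diff a b _, M => M (0, a) (0, b)
  | .posSum a b _, M => M (0, a) (1, b)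
  | .negSum a b _, M => M (1, b) (0, a)

/-- The nilpotent part `X_α(v) - 1` of a root element. -/
def rootNil (α : Root n) (v : RootSpace d α R) : Matrix (Idx n) (Idx n) (QuadExt R d) :=
  rootMatrix α v - 1

lemma rootMatrix_eq (α : Root n) (v : RootSpace d α R) : rootMatrix α v = 1 + rootNil α v := by
  simp [rootNil]

section Linear

variable (K : Type*) [CommRing K] [Algebra K R]

lemma star_smul_quadExt (c : K) (z : QuadExt R d) : star (c • z) = c • star z := by
  ext <;> simp

/-- `rootNil` as a linear map. -/
def rootNilₗ (α : Root n) : RootSpace d α R →ₗ[K] Matrix (Idx n) (Idx n) (QuadExt R d) where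
  toFun := rootNil α
  map_add' v w := by
    cases α with
    | posLong a =>
      have key (x y : R) : posLongMatrix a (algebraMap R (QuadExt R d) (x + y)) - 1 =
          (posLongMatrix a (algebraMap R (QuadExt R d) x) - 1) +
            (posLongMatrix a (algebraMap R (QuadExt R d) y) - 1) := by
        simp [posLongMatrix, Matrix.single_add]
      exact key v w
    | negLong a =>
      have key (x y : R) : negLongMatrix a (algebraMap R (QuadExt R d) (x + y)) - 1 =
          (negLongMatrix a (algebraMap R (QuadExt R d) x) - 1) +
            (negLongMatrix a (algebraMap R (QuadExt R d) y) - 1) := by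
        simp [negLongMatrix, Matrix.single_add]
      exact key v w
    | diff a b h =>
      have key (x y : QuadExt R d) : diffMatrix a b (x + y) - 1 =
          (diffMatrix a b x - 1) + (diffMatrix a b y - 1) := by
        simp only [diffMatrix, star_add, Matrix.single_add]
        abel
      exact key v w
    | posSum a b h =>
      have key (x y : QuadExt R d) : posSumMatrix a b (x + y) - 1 =
          (posSumMatrix a b x - 1) + (posSumMatrix a b y - 1) := by
        simp only [posSumMatrix, star_add, Matrix.single_add]
        abel
      exact key v w
    | negSum a b h =>
      have key (x y : QuadExt R d) : negSumMatrix a b (x + y) - 1 =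
          (negSumMatrix a b x - 1) + (negSumMatrix a b y - 1) := by
        simp only [negSumMatrix, star_add, Matrix.single_add]
        abel
      exact key v w
  map_smul' c v := by
    cases α with
    | posLong a =>
      have key (x : R) : posLongMatrix a (algebraMap R (QuadExt R d) (c • x)) - 1 =
          c • (posLongMatrix a (algebraMap R (QuadExt R d) x) - 1) := by
        simp only [posLongMatrix, add_sub_cancel_left, Matrix.smul_single]
        congr 1
        ext <;> simp
      exact key v
    | negLong a =>
      have key (x : R) : negLongMatrix a (algebraMap R (QuadExt R d) (c • x)) - 1 =
          c • (negLongMatrix a (algebraMap R (QuadExt R d) x) - 1) := by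
        simp only [negLongMatrix, add_sub_cancel_left, Matrix.smul_single]
        congr 1
        ext <;> simp
      exact key v
    | diff a b h =>
      have key (x : QuadExt R d) : diffMatrix a b (c • x) - 1 =
          c • (diffMatrix a b x - 1) := by
        simp only [diffMatrix, star_smul_quadExt, ← Matrix.smul_single]
        module
      exact key v
    | posSum a b h =>
      have key (x : QuadExt R d) : posSumMatrix a b (c • x) - 1 =
          c • (posSumMatrix a b x - 1) := by
        simp only [posSumMatrix, star_smul_quadExt, ← Matrix.smul_single]
        module
      exact key v
    | negSum a b h =>
      have key (x : QuadExt R d) : negSumMatrix a b (c • x) - 1 =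
          c • (negSumMatrix a b x - 1) := by
        simp only [negSumMatrix, star_smul_quadExt, ← Matrix.smul_single]
        module
      exact key v

/-- `coord` as a linear map. -/
def coordₗ (α : Root n) : Matrix (Idx n) (Idx n) (QuadExt R d) →ₗ[K] RootSpace d α R where
  toFun := coord α
  map_add' M N := by cases α <;> rfl
  map_smul' c M := by cases α <;> rfl

end Linear

lemma coord_map (g : R →ₐ[k] S) (α : Root n) (M : Matrix (Idx n) (Idx n) (QuadExt R d)) :
    coord α ((QuadExt.map d g).mapMatrix M) = RootSpace.map d α g (coord α M) := by
  cases α <;> rfl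

lemma coord_congr {α : Root n} {M N : Matrix (Idx n) (Idx n) (QuadExt R d)}
    (h : M α.pos.1 α.pos.2 = N α.pos.1 α.pos.2) : coord α M = coord α N := by
  cases α with
  | posLong a => exact congrArg QuadraticAlgebra.re h
  | negLong a => exact congrArg QuadraticAlgebra.re h
  | diff a b _ => exact h
  | posSum a b _ => exact h
  | negSum a b _ => exact h

lemma coord_rootNil (α : Root n) (v : RootSpace d α R) : coord α (rootNil α v) = v := by
  cases α with
  | posLong a =>
    have key (x : R) :
        ((posLongMatrix a (algebraMap R (QuadExt R d) x) - 1) (0, a) (1, a)).re = x := by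
      simp [posLongMatrix]
    exact key v
  | negLong a =>
    have key (x : R) :
        ((negLongMatrix a (algebraMap R (QuadExt R d) x) - 1) (1, a) (0, a)).re = x := by
      simp [negLongMatrix]
    exact key v
  | diff a b h =>
    have key (x : QuadExt R d) : (diffMatrix a b x - 1) (0, a) (0, b) = x := by
      simp [diffMatrix]
    exact key v
  | posSum a b h =>
    have key (x : QuadExt R d) : (posSumMatrix a b x - 1) (0, a) (1, b) = x := by
      simp [posSumMatrix, h.ne']
    exact key v
  | negSum a b h =>
    have key (x : QuadExt R d) : (negSumMatrix a b x - 1) (1, b) (0, a) = x := by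
      simp [negSumMatrix, h.ne']
    exact key v

/-- All nonzero entries of `M` lie at positions of weight `w`, i.e. `M` lies in the weight space
of `w` under conjugation by the torus. -/
def IsHomogeneous {B : Type*} [Zero B] (M : Matrix (Idx n) (Idx n) B) (w : Fin n → ℤ) : Prop :=
  ∀ p q, M p q ≠ 0 → wt p - wt q = w

lemma IsHomogeneous.mul {B : Type*} [NonUnitalNonAssocSemiring B]
    {M N : Matrix (Idx n) (Idx n) B} {w w' : Fin n → ℤ}
    (hM : IsHomogeneous M w) (hN : IsHomogeneous N w') : IsHomogeneous (M * N) (w + w') := by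
  intro p q h
  obtain ⟨r, -, hr⟩ := Finset.exists_ne_zero_of_sum_ne_zero (Matrix.mul_apply (M := M) ▸ h)
  rw [← hM p r (left_ne_zero_of_mul hr), ← hN r q (right_ne_zero_of_mul hr)]
  abel

lemma isHomogeneous_rootNil (α : Root n) (v : RootSpace d α R) :
    IsHomogeneous (rootNil α v) α.toChar := by
  rintro ⟨i, a'⟩ ⟨j, b'⟩ h
  rw [Root.toChar_eq]
  cases α with
  | posLong a =>
    simp only [rootNil, rootMatrix, posLongMatrix, add_sub_cancel_left, Matrix.single_apply, ne_eq,
      ite_eq_right_iff, Classical.not_imp] at h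
    obtain ⟨⟨h1, h2⟩, -⟩ := h
    rw [← h1, ← h2]; rfl
  | negLong a =>
    simp only [rootNil, rootMatrix, negLongMatrix, add_sub_cancel_left, Matrix.single_apply, ne_eq,
      ite_eq_right_iff, Classical.not_imp] at h
    obtain ⟨⟨h1, h2⟩, -⟩ := h
    rw [← h1, ← h2]; rfl
  | diff a b hab =>
    have key : ((0, a) = (i, a') ∧ ((0 : Fin 2), b) = (j, b')) ∨
        ((1, b) = (i, a') ∧ ((1 : Fin 2), a) = (j, b')) := by
      by_contra! hc
      refine h ?_
      simp [rootNil, rootMatrix, diffMatrix, add_sub_right_comm, Matrix.single_apply,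
        -Prod.mk.injEq]
      grind
    rcases key with ⟨h1, h2⟩ | ⟨h1, h2⟩ <;> rw [← h1, ← h2] <;> simp [Root.pos]
    abel
  | posSum a b hab =>
    have key : ((0, a) = (i, a') ∧ ((1 : Fin 2), b) = (j, b')) ∨
        ((0, b) = (i, a') ∧ ((1 : Fin 2), a) = (j, b')) := by
      by_contra! hc
      refine h ?_
      simp [rootNil, rootMatrix, posSumMatrix, add_sub_right_comm, Matrix.single_apply,
        -Prod.mk.injEq]
      grind
    rcases key with ⟨h1, h2⟩ | ⟨h1, h2⟩ <;> rw [← h1, ← h2] <;> simp [Root.pos]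
    abel
  | negSum a b hab =>
    have key : ((1, b) = (i, a') ∧ ((0 : Fin 2), a) = (j, b')) ∨
        ((1, a) = (i, a') ∧ ((0 : Fin 2), b) = (j, b')) := by
      by_contra! hc
      refine h ?_
      simp [rootNil, rootMatrix, negSumMatrix, add_sub_right_comm, Matrix.single_apply,
        -Prod.mk.injEq]
      grind
    rcases key with ⟨h1, h2⟩ | ⟨h1, h2⟩ <;> rw [← h1, ← h2] <;> simp [Root.pos]
    abel

end RootCoordinates

/-! ### The Chevalley commutator formula -/

section Commutator

variable {k : Type*} [Field k] {n : ℕ} {R S : Type*} [CommRing R] [Algebra k R]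
  [CommRing S] [Algebra k S] {d : k}

lemma rootElt_inv (α : Root n) (v : RootSpace d α R) : (rootElt α v)⁻¹ = rootElt α (-v) := by
  have h0 : rootElt α (0 : RootSpace d α R) = 1 := by
    have := rootElt_add α (0 : RootSpace d α R) 0
    rwa [add_zero, left_eq_mul] at this
  rw [inv_eq_iff_mul_eq_one, ← rootElt_add, add_neg_cancel, h0]

lemma rootNil_neg (α : Root n) (v : RootSpace d α R) : rootNil α (-v) = -rootNil α v :=
  map_neg (rootNilₗ R α) v

lemma rootNil_mul_self (α : Root n) (v : RootSpace d α R) : rootNil α v * rootNil α v = 0 := by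
  have h := rootMatrix_add α v (-v)
  have h0 : rootNil α (0 : RootSpace d α R) = 0 := map_zero (rootNilₗ R α)
  simp only [add_neg_cancel, rootMatrix_eq, h0, rootNil_neg] at h
  rw [eq_comm, ← sub_eq_zero] at h
  rw [← neg_eq_zero, ← h]
  noncomm_ring

/-- The matrix of `⁅X_α(u), X_β(v)⁆ - 1`. -/
def commNil (α β : Root n) (u : RootSpace d α R) (v : RootSpace d β R) :
    Matrix (Idx n) (Idx n) (QuadExt R d) :=
  (1 + rootNil α u) * (1 + rootNil β v) * (1 + -rootNil α u) * (1 + -rootNil β v) + -1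

lemma coe_commutator_rootElt (α β : Root n) (u : RootSpace d α R) (v : RootSpace d β R) :
    (⁅rootElt α u, rootElt β v⁆ : SU n R d).1.1 = 1 + commNil α β u v := by
  rw [commutatorElement_def, rootElt_inv, rootElt_inv, commNil, ← rootNil_neg, ← rootNil_neg,
    ← rootMatrix_eq, ← rootMatrix_eq, ← rootMatrix_eq, ← rootMatrix_eq]
  simp only [add_sub_cancel, ← sub_eq_add_neg]
  rfl

lemma commNil_map (g : R →ₐ[k] S) (α β : Root n) (u : RootSpace d α R) (v : RootSpace d β R) :
    commNil α β (RootSpace.map d α g u) (RootSpace.map d β g v) =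
      (QuadExt.map d g).mapMatrix (commNil α β u v) := by
  simp only [commNil, rootNil, rootMatrix_map, map_add, map_mul, map_neg, map_sub, map_one]

/-- All nonzero entries of `⁅X_α(u), X_β(v)⁆ - 1` have weight `iα + jβ` for some `i, j ≥ 1`. -/
lemma exists_comb_of_commNil_ne_zero {α β : Root n} {u : RootSpace d α R} {v : RootSpace d β R}
    {p q : Idx n} (h : commNil α β u v p q ≠ 0) :
    ∃ i j : ℕ, 1 ≤ i ∧ 1 ≤ j ∧ wt p - wt q = i • α.toChar + j • β.toChar := by
  have hY := isHomogeneous_rootNil α u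
  have hZ := isHomogeneous_rootNil β v
  have hY2 := rootNil_mul_self α u
  have hZ2 := rootNil_mul_self β v
  set Y := rootNil α u with hYdef
  set Z := rootNil β v with hZdef
  have expand : commNil α β u v = Y * Z - Z * Y + Z * Y * Z - Y * Z * Y + Y * Z * Y * Z := by
    have h0 : commNil α β u v = Y * Z - Z * Y + Z * Y * Z - Y * Z * Y + Y * Z * Y * Z
        - Y * Y - Z * Z + Y * Y * Z - Y * (Z * Z) := by
      rw [commNil, ← hYdef, ← hZdef]
      noncomm_ring
    rw [h0, hY2, hZ2]
    simp
  by_contra! hc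
  have vanish {M : Matrix (Idx n) (Idx n) (QuadExt R d)} {w} (hM : IsHomogeneous M w) (i j : ℕ)
      (hi : 1 ≤ i) (hj : 1 ≤ j) (hw : w = i • α.toChar + j • β.toChar) : M p q = 0 := by
    by_contra h0
    exact hc i j hi hj ((hM p q h0).trans hw)
  refine h ?_
  rw [expand]
  simp only [Matrix.add_apply, Matrix.sub_apply]
  rw [vanish (hY.mul hZ) 1 1 le_rfl le_rfl (by module),
    vanish (hZ.mul hY) 1 1 le_rfl le_rfl (by module),
    vanish ((hZ.mul hY).mul hZ) 1 2 le_rfl one_le_two (by module),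
    vanish ((hY.mul hZ).mul hY) 2 1 one_le_two le_rfl (by module),
    vanish (((hY.mul hZ).mul hY).mul hZ) 2 2 one_le_two one_le_two (by module)]
  simp

/-- A product of two entries has weight `iα + jβ` with `i, j ≥ 2`, which is too long to be the
weight of a position. -/
lemma commNil_mul_self {α β : Root n} (h : α.toChar ≠ -β.toChar)
    (u : RootSpace d α R) (v : RootSpace d β R) : commNil α β u v * commNil α β u v = 0 := by
  ext1 p q
  rw [Matrix.mul_apply]
  refine Finset.sum_eq_zero fun r _ => ?_
  by_contra h0
  obtain ⟨i, j, hi, hj, h1⟩ := exists_comb_of_commNil_ne_zero (left_ne_zero_of_mul h0)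
  obtain ⟨i', j', hi', hj', h2⟩ := exists_comb_of_commNil_ne_zero (right_ne_zero_of_mul h0)
  refine Root.comb_ne_wt_sub h (i := i + i') (j := j + j') (by omega) (by omega) p q ?_
  rw [add_smul, add_smul, add_add_add_comm, ← h1, ← h2]
  abel

lemma formMatrix_mul_zero {B : Type*} [CommRing B] (M : Matrix (Idx n) (Idx n) B) (a : Fin n)
    (q : Idx n) : (formMatrix n B * M) (0, a) q = -M (1, a) q := by
  simp [formMatrix, Matrix.mul_apply, Fintype.sum_prod_type, Matrix.blockDiagonal_apply]

lemma formMatrix_mul_one {B : Type*} [CommRing B] (M : Matrix (Idx n) (Idx n) B) (a : Fin n)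
    (q : Idx n) : (formMatrix n B * M) (1, a) q = M (0, a) q := by
  simp [formMatrix, Matrix.mul_apply, Fintype.sum_prod_type, Matrix.blockDiagonal_apply]

/-- If `1 + N` preserves the form and `N² = 0`, then `N` lies in the Lie algebra of `G`. -/
lemma isHermitian_formMatrix_mul {B : Type*} [CommRing B] [StarRing B]
    {N : Matrix (Idx n) (Idx n) B} (hN : N * N = 0)
    (h : (1 + N)ᴴ * formMatrix n B * (1 + N) = formMatrix n B) :
    (formMatrix n B * N)ᴴ = formMatrix n B * N := by
  have h1 : (1 + N) * (1 - N) = 1 := by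
    rw [Matrix.mul_sub, Matrix.mul_one, Matrix.add_mul, Matrix.one_mul, hN, add_zero,
      add_sub_cancel_right]
  have h2 : (1 + N)ᴴ * formMatrix n B = formMatrix n B * (1 - N) := by
    conv_rhs => rw [← h]
    rw [Matrix.mul_assoc, h1, Matrix.mul_one]
  rw [Matrix.conjTranspose_add, Matrix.conjTranspose_one, Matrix.add_mul, Matrix.one_mul,
    Matrix.mul_sub, Matrix.mul_one, sub_eq_add_neg, add_left_cancel_iff] at h2
  rw [Matrix.conjTranspose_mul, formMatrix_conjTranspose, Matrix.mul_neg, h2, neg_neg]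

/-- An element of the Lie algebra of `G` agrees at the positions of weight `γ` with its component
in the root space of `γ`. -/
lemma rootNil_coord_apply [CharZero k] {N : Matrix (Idx n) (Idx n) (QuadExt k d)}
    (hN : (formMatrix n _ * N)ᴴ = formMatrix n _ * N) {γ : Root n} {p q : Idx n}
    (h : wt p - wt q = γ.toChar) : rootNil γ (coord γ N) p q = N p q := by
  have hH (r s : Idx n) : 
      star ((formMatrix n (QuadExt k d) * N) r s) = (formMatrix n (QuadExt k d) * N) s r :=
    congrFun (congrFun hN s) r
  -- For long roots the entry is fixed by conjugation, hence rational in characteristic not 2.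
  have hre {z : QuadExt k d} (hz : star z = z) : algebraMap k (QuadExt k d) z.re = z := by
    have := congrArg QuadraticAlgebra.im hz
    rw [QuadraticAlgebra.im_star, neg_eq_self] at this
    ext
    · rfl
    · exact this.symm
  rw [Root.toChar_eq] at h
  have hpos := wt_sub_eq γ.pos_ne h.symm
  cases γ with
  | posLong a =>
    have hpq : p = (0, a) ∧ q = (1, a) := by
      simpa [Root.pos, dual] using hpos
    obtain ⟨rfl, rfl⟩ := hpq
    have h1 := hH (1, a) (1, a)
    rw [formMatrix_mul_one] at h1
    have : (posLongMatrix a (algebraMap k (QuadExt k d) (N (0, a) (1, a)).re) - 1) (0, a) (1, a)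
        = N (0, a) (1, a) := by
      rw [hre h1]; simp [posLongMatrix]
    exact this
  | negLong a =>
    have hpq : p = (1, a) ∧ q = (0, a) := by
      simpa [Root.pos, dual] using hpos
    obtain ⟨rfl, rfl⟩ := hpq
    have h1 := hH (0, a) (0, a)
    rw [formMatrix_mul_zero, star_neg, neg_inj] at h1
    have : (negLongMatrix a (algebraMap k (QuadExt k d) (N (1, a) (0, a)).re) - 1) (1, a) (0, a)
        = N (1, a) (0, a) := by
      rw [hre h1]; simp [negLongMatrix]
    exact this
  | diff a b hab =>
    have hpq : (p = (0, a) ∧ q = (0, b)) ∨ (p = (1, b) ∧ q = (1, a)) := by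
      simpa [Root.pos, dual] using hpos
    change (diffMatrix a b (N (0, a) (0, b)) - 1) p q = N p q
    rcases hpq with ⟨rfl, rfl⟩ | ⟨rfl, rfl⟩
    · simp [diffMatrix]
    · have h1 := hH (1, a) (0, b)
      rw [formMatrix_mul_one, formMatrix_mul_zero] at h1
      simp [diffMatrix, h1, hab.symm]
  | posSum a b hab =>
    have hpq : (p = (0, a) ∧ q = (1, b)) ∨ (p = (0, b) ∧ q = (1, a)) := by
      simpa [Root.pos, dual] using hpos
    change (posSumMatrix a b (N (0, a) (1, b)) - 1) p q = N p q
    rcases hpq with ⟨rfl, rfl⟩ | ⟨rfl, rfl⟩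
    · simp [posSumMatrix, hab.ne']
    · have h1 := hH (1, a) (1, b)
      rw [formMatrix_mul_one, formMatrix_mul_one] at h1
      simp [posSumMatrix, h1, hab.ne]
  | negSum a b hab =>
    have hpq : (p = (1, b) ∧ q = (0, a)) ∨ (p = (1, a) ∧ q = (0, b)) := by
      simpa [Root.pos, dual] using hpos
    change (negSumMatrix a b (N (1, b) (0, a)) - 1) p q = N p q
    rcases hpq with ⟨rfl, rfl⟩ | ⟨rfl, rfl⟩
    · simp [negSumMatrix, hab.ne']
    · have h1 := hH (0, b) (0, a)
      rw [formMatrix_mul_zero, formMatrix_mul_zero, star_neg, neg_inj] at h1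
      simp [negSumMatrix, h1, hab.ne]

/-- The root subgroups of the roots `iα + jβ`, `i, j ≥ 1`, multiply by adding the nilpotent
parts. -/
lemma coe_prod_rootElt {α β : Root n} (h : α.toChar ≠ -β.toChar) {l : List (Root n)}
    (hl : ∀ γ ∈ l, ∃ i j : ℕ, 1 ≤ i ∧ 1 ≤ j ∧ γ.toChar = i • α.toChar + j • β.toChar)
    (w : ∀ γ : Root n, RootSpace d γ R) :
    ((l.map fun γ => rootElt γ (w γ)).prod).1.1 = 1 + (l.map fun γ => rootNil γ (w γ)).sum := by
  induction l with
  | nil => simp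
  | cons γ l ih =>
    have hγ := hl γ List.mem_cons_self
    have hl' := fun δ hδ => hl δ (List.mem_cons_of_mem γ hδ)
    have hmul : rootNil γ (w γ) * (l.map fun δ => rootNil δ (w δ)).sum = 0 := by
      rw [← List.sum_map_mul_left]
      refine List.sum_eq_zero fun x hx => ?_
      obtain ⟨δ, hδ, rfl⟩ := List.mem_map.mp hx
      ext1 p q
      by_contra h0
      obtain ⟨i, j, hi, hj, h1⟩ := hγ
      obtain ⟨i', j', hi', hj', h2⟩ := hl' δ hδ
      refine Root.comb_ne_wt_sub h (i := i + i') (j := j + j') (by omega) (by omega) p q ?_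
      rw [((isHomogeneous_rootNil γ _).mul (isHomogeneous_rootNil δ _)) p q h0, h1, h2]
      module
    have hcoe : ((rootElt γ (w γ)).1.1 : Matrix (Idx n) (Idx n) (QuadExt R d))
        = 1 + rootNil γ (w γ) := rootMatrix_eq _ _
    rw [List.map_cons, List.prod_cons, List.map_cons, List.sum_cons, Subgroup.coe_mul,
      Matrix.SpecialLinearGroup.coe_mul, ih hl', hcoe, Matrix.add_mul, Matrix.mul_add, Matrix.mul_add,
      hmul]
    simp only [Matrix.one_mul, Matrix.mul_one, add_zero]
    abel

/-- Only the summand of the root `γ` has a nonzero entry at a position of weight `γ`. -/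
lemma sum_rootNil_apply {l : List (Root n)} (hl : l.Nodup) (w : ∀ γ : Root n, RootSpace d γ R)
    {γ : Root n} (hγ : γ ∈ l) {p q : Idx n} (h : wt p - wt q = γ.toChar) :
    (l.map fun δ => rootNil δ (w δ)).sum p q = rootNil γ (w γ) p q := by
  classical
  have h0 (δ : Root n) (hδ : δ ≠ γ) : rootNil δ (w δ) p q = 0 := by
    by_contra hne
    exact hδ (Root.toChar_injective ((isHomogeneous_rootNil δ _ p q hne).symm.trans h))
  rw [← List.sum_toFinset _ hl, Matrix.sum_apply]
  exact Finset.sum_eq_single γ (fun δ _ hδ => h0 δ hδ)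
    fun hc => absurd (List.mem_toFinset.mpr hγ) hc

/-- The parameters in the Chevalley commutator formula are uniquely determined: they are
coordinates of the commutator. -/
lemma eq_coord_commNil {α β : Root n} (h : α.toChar ≠ -β.toChar) {u : RootSpace d α R}
    {v : RootSpace d β R} {l : List (Root n)} (hl : IsRootList α β l)
    {w : ∀ γ : Root n, RootSpace d γ R}
    (hw : ⁅rootElt α u, rootElt β v⁆ = (l.map fun γ => rootElt γ (w γ)).prod)
    {γ : Root n} (hγ : γ ∈ l) : w γ = coord γ (commNil α β u v) := by
  have h1 := congrArg (fun x : SU n R d => x.1.1) hw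
  simp only [coe_commutator_rootElt, coe_prod_rootElt h (fun γ hγ => (hl.2 γ).mp hγ),
    add_left_cancel_iff] at h1
  rw [h1]
  refine (coord_rootNil γ (w γ)).symm.trans (coord_congr ?_)
  rw [sum_rootNil_apply hl.1 w hγ γ.toChar_eq.symm]

/-- The Chevalley commutator formula over the base field, with the parameters given as coordinates
of the commutator. -/
lemma commutator_rootElt [CharZero k] {α β : Root n} (h : α.toChar ≠ -β.toChar)
    (u : RootSpace d α k) (v : RootSpace d β k) {l : List (Root n)} (hl : IsRootList α β l) :
    ⁅rootElt α u, rootElt β v⁆ =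
      (l.map fun γ => rootElt γ (coord γ (commNil α β u v))).prod := by
  have hherm := isHermitian_formMatrix_mul (commNil_mul_self h u v) (by
    rw [← coe_commutator_rootElt]
    exact (⁅rootElt α u, rootElt β v⁆ : SU n k d).2)
  refine Subtype.ext (Subtype.ext ?_)
  rw [coe_commutator_rootElt, coe_prod_rootElt h fun γ hγ => (hl.2 γ).mp hγ]
  congr 1
  ext1 p q
  by_cases hpq : ∃ γ ∈ l, wt p - wt q = γ.toChar
  · obtain ⟨γ, hγ, hwt⟩ := hpq
    rw [sum_rootNil_apply hl.1 _ hγ hwt, rootNil_coord_apply hherm hwt]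
  · have hL : commNil α β u v p q = 0 := by
      by_contra h0
      obtain ⟨i, j, hi, hj, hwt⟩ := exists_comb_of_commNil_ne_zero h0
      have hne : p ≠ q := by
        rintro rfl
        exact Root.comb_ne_zero h hi hj (by rw [← hwt, sub_self])
      obtain ⟨γ, hγ⟩ := Root.exists_toChar_eq hne
      exact hpq ⟨γ, (hl.2 γ).mpr ⟨i, j, hi, hj, hγ.trans hwt⟩, hγ.symm⟩
    classical
    rw [hL, ← List.sum_toFinset _ hl.1, Matrix.sum_apply, eq_comm]
    refine Finset.sum_eq_zero fun γ hγ => ?_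
    by_contra h0
    exact hpq ⟨γ, List.mem_toFinset.mp hγ, isHomogeneous_rootNil γ _ p q h0⟩

end Commutator

/-! ### Density of the rational points and extension of the Steinberg relations -/

lemma Steinberg.lift_X {k : Type*} [Field k] {n : ℕ} {R : Type*} [CommRing R] [Algebra k R]
    {d : k} {Γ : Type*} [Group Γ] (Y : ∀ α : Root n, RootSpace d α R → Γ) (hadd hcomm)
    (α : Root n) (v : RootSpace d α R) : lift Y hadd hcomm (X α v) = Y α v :=
  PresentedGroup.toGroup.of _

section Extension

variable {k : Type*} [Field k] {n : ℕ} {d : k} {K : Type*} [Field K]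
  {A : Type*} [CommRing A] [Algebra K A] [Algebra k A]

/-- If `k` is dense in `A`, then `V_α(k)` is dense in `V_α(A)`. -/
lemma isZariskiDense_range_rootSpaceMap
    (hf : IsZariskiDense K (Set.range (algebraMap k A))) (α : Root n) :
    IsZariskiDense K (Set.range (RootSpace.map d α (Algebra.ofId k A))) := by
  let L : A × A →ₗ[K] QuadExt A d :=
    { toFun := fun p => ⟨p.1, p.2⟩, map_add' := fun _ _ => rfl, map_smul' := fun _ _ => rfl }
  have hL : IsZariskiDense K (Set.range (QuadExt.map d (Algebra.ofId k A))) := by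
    convert (hf.prod hf).image L fun z => ⟨(z.re, z.im), rfl⟩
    ext z
    constructor
    · rintro ⟨x, rfl⟩
      exact ⟨(algebraMap k A x.re, algebraMap k A x.im), ⟨⟨_, rfl⟩, ⟨_, rfl⟩⟩, rfl⟩
    · rintro ⟨_, ⟨⟨x, hx⟩, ⟨y, hy⟩⟩, rfl⟩
      exact ⟨⟨x, y⟩, QuadraticAlgebra.ext hx hy⟩
  cases α with
  | posLong a => exact hf
  | negLong a => exact hf
  | diff a b h => exact hL
  | posSum a b h => exact hL
  | negSum a b h => exact hL

/-- The maps `N_{ij}^{αβ}` of the commutator formula are polynomial. -/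
lemma isPolyMap_coord_commNil [Module.Finite K A] (α β γ : Root n) :
    IsPolyMap K fun x : RootSpace d α A × RootSpace d β A =>
      coord γ (commNil α β x.1 x.2) := by
  have : Module.Finite K (QuadExt A d) := Module.Finite.trans A _
  have hu := (LinearMap.isPolyMap (LinearMap.fst K (RootSpace d α A)
    (RootSpace d β A))).linear_comp (rootNilₗ K α)
  have hv := (LinearMap.isPolyMap (LinearMap.snd K (RootSpace d α A)
    (RootSpace d β A))).linear_comp (rootNilₗ K β)
  have hu' := hu.linear_comp (-LinearMap.id)
  have hv' := hv.linear_comp (-LinearMap.id)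
  have h1 := IsPolyMap.const (K := K) (P := RootSpace d α A × RootSpace d β A)
    (1 : Matrix (Idx n) (Idx n) (QuadExt A d))
  exact (((((h1.add hu).mul (h1.add hv)).mul (h1.add hu')).mul (h1.add hv')).add
    (IsPolyMap.const (-1))).linear_comp (coordₗ K γ)

variable {m : ℕ} {H : Subgroup (GL (Fin m) K)} (ρ : SU n k d →* GL (Fin m) K)
  (ψ : ∀ α : Root n, RootSpace d α A → H)

/-- Regular maps that restrict to a homomorphism on the rational points of a root subgroup are
additive. -/
lemma regular_extension_add (hf : IsZariskiDense K (Set.range (algebraMap k A)))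
    (hψ_regular : ∀ α, IsRegularMap (ψ α))
    (hψ : ∀ (α : Root n) (v : RootSpace d α k),
      (ψ α (RootSpace.map d α (Algebra.ofId k A) v) : GL (Fin m) K) = ρ (rootElt α v))
    (α : Root n) (v w : RootSpace d α A) : ψ α v * ψ α w = ψ α (v + w) := by
  have hdense := (isZariskiDense_range_rootSpaceMap (d := d) hf α).prod
    (isZariskiDense_range_rootSpaceMap (d := d) hf α)
  have hfst := (hψ_regular α).comp_mem_regularMaps (LinearMap.isPolyMap
    (LinearMap.fst K (RootSpace d α A) (RootSpace d α A)))
  have hsnd := (hψ_regular α).comp_mem_regularMaps (LinearMap.isPolyMap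
    (LinearMap.snd K (RootSpace d α A) (RootSpace d α A)))
  have hsum := (hψ_regular α).comp_mem_regularMaps (LinearMap.isPolyMap
    (LinearMap.fst K (RootSpace d α A) (RootSpace d α A) + LinearMap.snd K _ _))
  have key := hdense.eq_of_mem_regularMaps (mul_mem hfst hsnd) hsum (by
    rintro ⟨_, _⟩ ⟨⟨x, rfl⟩, ⟨y, rfl⟩⟩
    change (ψ α (RootSpace.map d α (Algebra.ofId k A) x) : GL (Fin m) K) *
      ψ α (RootSpace.map d α (Algebra.ofId k A) y) =
        ψ α (RootSpace.map d α (Algebra.ofId k A) x + RootSpace.map d α (Algebra.ofId k A) y)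
    rw [← map_add, hψ, hψ, hψ, rootElt_add, map_mul])
  exact Subtype.ext (congrFun key (v, w))

/-- The Chevalley commutator formula extends by density from the rational points of the root
subgroups to regular maps. -/
lemma regular_extension_commutator [CharZero k] [Module.Finite K A]
    (hf : IsZariskiDense K (Set.range (algebraMap k A)))
    (hψ_regular : ∀ α, IsRegularMap (ψ α))
    (hψ : ∀ (α : Root n) (v : RootSpace d α k),
      (ψ α (RootSpace.map d α (Algebra.ofId k A) v) : GL (Fin m) K) = ρ (rootElt α v))
    {α β : Root n} (h : α.toChar ≠ -β.toChar) {l : List (Root n)} (hl : IsRootList α β l)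
    (u : RootSpace d α A) (v : RootSpace d β A) :
    ⁅ψ α u, ψ β v⁆ = (l.map fun γ => ψ γ (coord γ (commNil α β u v))).prod := by
  have hdense := (isZariskiDense_range_rootSpaceMap (d := d) hf α).prod
    (isZariskiDense_range_rootSpaceMap (d := d) hf β)
  have hu := (hψ_regular α).comp_mem_regularMaps (LinearMap.isPolyMap
    (LinearMap.fst K (RootSpace d α A) (RootSpace d β A)))
  have hv := (hψ_regular β).comp_mem_regularMaps (LinearMap.isPolyMap
    (LinearMap.snd K (RootSpace d α A) (RootSpace d β A)))
  have hprod : (l.map fun γ => fun x : RootSpace d α A × RootSpace d β A =>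
      (ψ γ (coord γ (commNil α β x.1 x.2)) : GL (Fin m) K)).prod ∈ regularMaps K _ m := by
    refine list_prod_mem fun F hF => ?_
    obtain ⟨γ, -, rfl⟩ := List.mem_map.mp hF
    exact (hψ_regular γ).comp_mem_regularMaps (isPolyMap_coord_commNil α β γ)
  have hcomm := mul_mem (mul_mem (mul_mem hu hv) (inv_mem hu)) (inv_mem hv)
  have happly (x : RootSpace d α A × RootSpace d β A) :
      (l.map fun γ => fun x : RootSpace d α A × RootSpace d β A =>
        (ψ γ (coord γ (commNil α β x.1 x.2)) : GL (Fin m) K)).prod x =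
      (l.map fun γ => (ψ γ (coord γ (commNil α β x.1 x.2)) : GL (Fin m) K)).prod := by
    refine (map_list_prod (Pi.evalMonoidHom (fun _ => GL (Fin m) K) x) _).trans ?_
    rw [List.map_map]
    rfl
  have key := hdense.eq_of_mem_regularMaps hcomm hprod (by
    rintro ⟨_, _⟩ ⟨⟨x, rfl⟩, ⟨y, rfl⟩⟩
    rw [happly]
    change ⁅(ψ α (RootSpace.map d α (Algebra.ofId k A) x) : GL (Fin m) K),
      (ψ β (RootSpace.map d β (Algebra.ofId k A) y) : GL (Fin m) K)⁆ = _
    simp only [commNil_map, coord_map, hψ]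
    rw [← map_commutatorElement, commutator_rootElt h x y hl, map_list_prod, List.map_map]
    rfl)
  refine Subtype.ext ?_
  have := (congrFun key (u, v)).trans (happly (u, v))
  rw [Subgroup.val_list_prod, List.map_map]
  exact this

end Extension

end QuasiSplitSU

end

theorem proposition3p5
    {k : Type*} [Field k] [CharZero k] (d : k) (hd : ¬ IsSquare d) (n : ℕ) (hn : 2 ≤ n)
    {K : Type*} [Field K] [IsAlgClosed K] [CharZero K] (m : ℕ)
    (ρ : QuasiSplitSU.SU n k d →* Matrix.GeneralLinearGroup (Fin m) K)
    (A : Type*) [CommRing A] [Algebra K A] [Module.Finite K A]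
    -- `A` is a `k`-algebra through the ring homomorphism `f = algebraMap k A`
    [Algebra k A]
    (hf : QuasiSplitSU.IsZariskiDense K (Set.range (algebraMap k A)))
    (ψ : ∀ α : QuasiSplitSU.Root n,
      QuasiSplitSU.RootSpace d α A → QuasiSplitSU.zariskiClosure ρ.range)
    (hψ_regular : ∀ α, QuasiSplitSU.IsRegularMap (ψ α))
    (hψ : ∀ (α : QuasiSplitSU.Root n) (v : QuasiSplitSU.RootSpace d α k),
      (ψ α (QuasiSplitSU.RootSpace.map d α (Algebra.ofId k A) v) :
        Matrix.GeneralLinearGroup (Fin m) K) = ρ (QuasiSplitSU.rootElt α v)) :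
    ∃ σ : QuasiSplitSU.Steinberg n A d →* QuasiSplitSU.zariskiClosure ρ.range,
      (∀ x : QuasiSplitSU.Steinberg n k d,
        (σ (QuasiSplitSU.Steinberg.map (Algebra.ofId k A) x) :
          Matrix.GeneralLinearGroup (Fin m) K) = ρ (QuasiSplitSU.Steinberg.toSU x)) ∧
      ∀ (α : QuasiSplitSU.Root n) (v : QuasiSplitSU.RootSpace d α A),
        σ (QuasiSplitSU.Steinberg.X α v) = ψ α v := by
  open QuasiSplitSU in
  let σ : Steinberg n A d →* zariskiClosure ρ.range :=
    Steinberg.lift ψ (regular_extension_add ρ ψ hf hψ_regular hψ) (by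
      intro α β _ h u v l hl w hw
      rw [regular_extension_commutator ρ ψ hf hψ_regular hψ h hl u v]
      refine congrArg List.prod (List.map_congr_left fun γ hγ => ?_)
      rw [eq_coord_commNil h hl hw hγ])
  have hσ (α : Root n) (v : RootSpace d α A) : σ (Steinberg.X α v) = ψ α v :=
    Steinberg.lift_X _ _ _ _ _
  refine ⟨σ, fun x => ?_, hσ⟩
  have hext : ((zariskiClosure ρ.range).subtype.comp σ).comp (Steinberg.map (Algebra.ofId k A)) =
      ρ.comp Steinberg.toSU := by
    refine PresentedGroup.ext fun ⟨α, v⟩ => ?_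
    change (σ (Steinberg.map (Algebra.ofId k A) (Steinberg.X α v)) : GL (Fin m) K) =
      ρ (Steinberg.toSU (Steinberg.X α v))
    have h1 : Steinberg.map (Algebra.ofId k A) (Steinberg.X α v) =
        Steinberg.X α (RootSpace.map d α (Algebra.ofId k A) v) := Steinberg.lift_X _ _ _ _ _
    have h2 : Steinberg.toSU (Steinberg.X α v) = rootElt α v := Steinberg.lift_X _ _ _ _ _
    rw [h1, h2, hσ, hψ]
  exact DFunLike.congr_fun hext x
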